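/- Let $\mathrm{Diff}^\delta_+S^1$ be the group of orientation preserving $C^\infty$ diffeomorphisms of the circle, regarded as a discrete group, let $\mathrm{SO}(2)\subset \mathrm{Diff}^\delta_+S^1$ be the subgroup of rotations and $\mathrm{SO}(2)_{\mathrm{tor}}$ the subgroup of rational rotations (rotations of finite order). Let $\chi\in H^2(\mathrm{Diff}^\delta_+S^1;\mathbb{Z})$ be the Euler class, i.e. the class of the central extension $$0\to\mathbb{Z}\to\widetilde{\mathrm{Diff}}_+S^1\to \mathrm{Diff}_+S^1\to 1$$ given by the universal covering group $\widetilde{\mathrm{Diff}}_+S^1=\{f\in\mathrm{Diff}^\infty_+\mathbb{R} : fT=Tf\}$, $T(x)=x+1$. Let $\Gamma\subset \mathrm{Diff}^\delta_+S^1$ be any subgroup containing $\mathrm{SO}(2)$, let $i:\mathrm{SO}(2)_{\mathrm{tor}}\to\Gamma$ be the inclusion, and denote the restriction of $\chi$ to $\Gamma$ again by $\chi$. (Co)homology of a group is taken with trivial coefficients. For every $l\ge 1$ one has $H_{2l-1}(\mathrm{SO}(2)_{\mathrm{tor}};\mathbb{Z})\cong\mathbb{Q}/\mathbb{Z}$;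 consider the homomorphisms $$i_*:H_{2l-1}(\mathrm{SO}(2)_{\mathrm{tor}};\mathbb{Z})\cong\mathbb{Q}/\mathbb{Z}\longrightarrow H_{2l-1}(\Gamma;\mathbb{Z}).\qquad(*)$$ (i) If for some $k\ge 1$ the homomorphism $(*)$ with $l=k$ is injective (resp. non-trivial), then $(*)$ is injective (resp. non-trivial) for all $l\ge k$. (ii) Let $k\ge 1$ and assume that $\chi^k=0$ in $H^{2k}(\Gamma;\mathbb{Q})$. Then the homomorphisms $(*)$ are injective for all $l\ge k$. They are detected by secondary classes: call $x\in H^{2k-1}(\Gamma;\mathbb{Q}/\mathbb{Z})$ a secondary class $\widehat{\chi^k}$ if there are a cocycle $c\in Z^2(\Gamma;\mathbb{Z})$ with $[c]=\chi$ and a cochain $a\in C^{2k-1}(\Gamma;\mathbb{Q})$ with $\delta a=c^k$ such that $x$ is the class of the reduction of $a$ modulo $\mathbb{Z}$. Such classes exist, and for each of them and each $l\ge k$ the homomorphism $$H_{2l-1}(\mathrm{SO}(2)_{\mathrm{tor}};\mathbb{Z})\longrightarrow\mathbb{Q}/\mathbb{Z},\qquad \sigma\longmapsto\langle \widehat{\chi^k}\cup\chi^{l-k},\,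 i_*\sigma\rangle$$ is bijective. -/

import Mathlib

set_option linter.unusedSectionVars false

noncomputable section

namespace GroupClasses

open CategoryTheory

/-- The group homology `H_n(G; ℤ)` with trivial integer coefficients. -/
abbrev Homol (G : Type) [Group G] (n : ℕ) : ModuleCat ℤ := groupHomology (Rep.trivial ℤ G ℤ) n

/-- The group cohomology `H^n(G; A)` with coefficients in the trivial module `A`. -/
abbrev Cohom (G A : Type) [Group G] [AddCommGroup A] (n : ℕ) : ModuleCat ℤ :=
  groupCohomology (Rep.trivial ℤ G A) n

/-- The group of inhomogeneous `n`-cocycles of `G` with values in the trivial module `A`. -/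
abbrev Cocycle (G A : Type) [Group G] [AddCommGroup A] (n : ℕ) : ModuleCat ℤ :=
  groupCohomology.cocycles (Rep.trivial ℤ G A) n

section
variable {G H : Type} [Group G] [Group H] {A B : Type} [AddCommGroup A] [AddCommGroup B]

/-- The cohomology class of a cocycle. -/
def cls {n : ℕ} (z : Cocycle G A n) : Cohom G A n := groupCohomology.π (Rep.trivial ℤ G A) n z

/-- The function `G^n → A` underlying a cocycle. -/
def val {n : ℕ} (z : Cocycle G A n) : (Fin n → G) → A :=
  groupCohomology.iCocycles (Rep.trivial ℤ G A) n z

/-- The coboundary `δ : C^n(G; A) → C^{n+1}(G; A)` of inhomogeneous cochains. -/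
def delta {n : ℕ} (f : (Fin n → G) → A) : (Fin (n + 1) → G) → A :=
  inhomogeneousCochains.d (Rep.trivial ℤ G A) n f

theorem delta_apply {n : ℕ} (f : (Fin n → G) → A) (g : Fin (n + 1) → G) :
    delta f g = f (fun i => g i.succ) +
      ∑ j : Fin (n + 1), (-1 : ℤ) ^ ((j : ℕ) + 1) • f (Fin.contractNth j (· * ·) g) := rfl

theorem d_eq_delta {n : ℕ} (f : (Fin n → G) → A) :
    (groupCohomology.inhomogeneousCochains (Rep.trivial ℤ G A)).d n (n + 1) f = delta f := by
  rw [groupCohomology.inhomogeneousCochains.d_def]; rfl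

theorem delta_val {n : ℕ} (z : Cocycle G A n) : delta (val z) = 0 := by
  rw [← d_eq_delta]
  exact congrArg (fun φ => φ.hom z)
    ((groupCohomology.inhomogeneousCochains (Rep.trivial ℤ G A)).iCycles_d n (n + 1))

theorem val_injective {n : ℕ} : Function.Injective (val : Cocycle G A n → _) :=
  (ModuleCat.mono_iff_injective (groupCohomology.iCocycles (Rep.trivial ℤ G A) n)).1 inferInstance

/-- The cocycle given by a cochain `f` with `δ f = 0`. -/
def mkCocycle {n : ℕ} (f : (Fin n → G) → A) (h : delta f = 0) : Cocycle G A n :=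
  groupCohomology.cocyclesMk f h

theorem val_mkCocycle {n : ℕ} (f : (Fin n → G) → A) (h : delta f = 0) :
    val (mkCocycle f h) = f :=
  groupCohomology.iCocycles_mk (A := Rep.trivial ℤ G A) f h

theorem cls_surjective {n : ℕ} : Function.Surjective (cls : Cocycle G A n → Cohom G A n) := fun x =>
  groupCohomology_induction_on (A := Rep.trivial ℤ G A) x fun z => ⟨z, rfl⟩

theorem cls_sub {n : ℕ} (z w : Cocycle G A n) : cls (z - w) = cls z - cls w :=
  map_sub (groupCohomology.π (Rep.trivial ℤ G A) n).hom z w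

theorem val_sub {n : ℕ} (z w : Cocycle G A n) : val (z - w) = val z - val w :=
  map_sub (groupCohomology.iCocycles (Rep.trivial ℤ G A) n).hom z w

theorem cls_eq_zero_iff {n i : ℕ} (hi : (ComplexShape.up ℕ).prev n = i) (z : Cocycle G A n) :
    cls z = 0 ↔ ∃ y : (Fin i → G) → A,
      (groupCohomology.inhomogeneousCochains (Rep.trivial ℤ G A)).d i n y = val z := by
  set K := groupCohomology.inhomogeneousCochains (Rep.trivial ℤ G A) with hK
  have ex := ShortComplex.exact_of_g_is_cokernel
    (ShortComplex.mk _ _ (K.toCycles_comp_homologyπ i n)) (K.homologyIsCokernel i n hi)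
  rw [ShortComplex.moduleCat_exact_iff] at ex
  have key : ∀ y : K.X i, K.d i n y = val (K.toCycles i n y : Cocycle G A n) := fun y =>
    (congrArg (fun φ => φ.hom y) (K.toCycles_i i n)).symm
  constructor
  · intro h
    obtain ⟨y, hy⟩ := ex z h
    refine ⟨y, (key y).trans (congrArg val hy)⟩
  · rintro ⟨y, hy⟩
    have : z = K.toCycles i n y := val_injective ((key y).symm.trans hy).symm
    rw [this]
    exact congrArg (fun φ => φ.hom y) (K.toCycles_comp_homologyπ i n)

theorem cls_zero_degree {z : Cocycle G A 0} (h : cls z = 0) : val z = 0 := by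
  obtain ⟨y, hy⟩ := (cls_eq_zero_iff (i := 0) (by simp) z).1 h
  rw [← hy, HomologicalComplex.shape _ _ _ (by simp)]; rfl

theorem cls_succ_eq_zero_iff {n : ℕ} (z : Cocycle G A (n + 1)) :
    cls z = 0 ↔ ∃ y : (Fin n → G) → A, delta y = val z := by
  rw [cls_eq_zero_iff (i := n) (by simp)]
  simp only [← d_eq_delta]

/-- The cup product of inhomogeneous cochains,
`(a ∪ b)(g₁, …, g_{m+n}) = b(g_{m+1}, …, g_{m+n}) • a(g₁, …, g_m)`. -/
def cupFun {m n p : ℕ} (h : m + n = p) (a : (Fin m → G) → A) (b : (Fin n → G) → ℤ) :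
    (Fin p → G) → A := fun g =>
  b (fun j => g (Fin.cast h (Fin.natAdd m j))) • a (fun i => g (Fin.cast h (Fin.castAdd n i)))

theorem delta_cupFun {m n p : ℕ} (h : m + n = p) (a : (Fin m → G) → A) (b : (Fin n → G) → ℤ) :
    delta (cupFun h a b) =
      cupFun (show m + 1 + n = p + 1 by omega) (delta a) b +
      (-1 : ℤ) ^ m • cupFun (show m + (n + 1) = p + 1 by omega) a (delta b) := by
  subst h
  funext g
  have e1 : ∀ j : Fin m, cupFun rfl a b (Fin.contractNth (Fin.castAdd (n + 1) j) (· * ·) g) =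
      b (fun i => g (Fin.natAdd (m + 1) i |>.cast (by omega))) •
      a (Fin.contractNth j.castSucc (· * ·) (fun i : Fin (m + 1) => g (Fin.cast (by omega) (Fin.castAdd n i)))) := by
    intro j
    simp only [cupFun]
    congr 2
    · funext i
      rw [Fin.contractNth_apply_of_gt _ _ _ _ (by simp; omega)]
      congr 1; ext; simp; omega
  have e2 : ∀ j : Fin (n + 1), cupFun rfl a b (Fin.contractNth (Fin.natAdd m j) (· * ·) g) =
      b (Fin.contractNth j (· * ·) (fun i : Fin (n + 1) => g (Fin.natAdd m i))) •
      a (fun i => g (Fin.castAdd (n + 1) i)) := by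
    intro j
    simp only [cupFun]
    congr 2
    · funext i
      simp only [Fin.contractNth]
      simp
      rfl
    · funext i
      rw [Fin.contractNth_apply_of_lt _ _ _ _ (by simp; omega)]
      rfl
  have e3 : a (Fin.contractNth (Fin.last m) (· * ·)
      (fun i : Fin (m + 1) => g (Fin.cast (by omega) (Fin.castAdd n i)))) =
      a (fun i => g (Fin.castAdd (n + 1) i)) := by
    congr 1
    funext i
    rw [Fin.contractNth_apply_of_lt _ _ _ _ (by simp)]
    rfl
  have e4 : (fun i : Fin n => g (Fin.natAdd m i.succ)) =
      fun i => g (Fin.natAdd (m + 1) i |>.cast (by omega)) := by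
    funext i; congr 1; ext; simp; omega
  have s : ∑ j : Fin (m + n + 1), (-1 : ℤ) ^ ((j : ℕ) + 1) •
        cupFun rfl a b (Fin.contractNth j (· * ·) g) =
      ∑ j : Fin m, (-1 : ℤ) ^ ((j : ℕ) + 1) •
        cupFun rfl a b (Fin.contractNth (Fin.castAdd (n + 1) j) (· * ·) g) +
      ∑ j : Fin (n + 1), (-1 : ℤ) ^ (m + (j : ℕ) + 1) •
        cupFun rfl a b (Fin.contractNth (Fin.natAdd m j) (· * ·) g) :=
    Fin.sum_univ_add (a := m) (b := n + 1) (fun j => (-1 : ℤ) ^ ((j : ℕ) + 1) •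
        cupFun (G := G) (A := A) rfl a b (Fin.contractNth j (· * ·) g))
  rw [delta_apply, s]
  simp only [e1, e2]
  simp only [Pi.add_apply, Pi.smul_apply, cupFun, delta_apply, Fin.sum_univ_castSucc (n := m)]
  generalize hX : b (fun j : Fin n => g (Fin.cast _ (Fin.natAdd (m + 1) j))) = X
  generalize hY : a (fun i : Fin m => g (Fin.castAdd (n + 1) i)) = Y
  have f1 : b (fun j => g (Fin.cast rfl (Fin.natAdd m j)).succ) = X := by
    rw [← hX]; exact congrArg b (by funext j; congr 1; ext; simp; omega)
  have f2 : b (fun i => g (Fin.cast rfl (Fin.natAdd m i.succ))) = X := by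
    rw [← hX]; exact congrArg b (by funext j; congr 1; ext; simp; omega)
  have f3 : a (Fin.contractNth (Fin.last m) (· * ·)
      (fun i : Fin (m + 1) => g (Fin.cast (by omega) (Fin.castAdd n i)))) = Y := e3.trans hY
  have f5 : a (fun i => g (Fin.cast rfl (Fin.castAdd (n + 1) i))) = Y := hY
  rw [f1, f2, f3, f5]
  simp only [smul_add, add_smul, Finset.smul_sum, Finset.sum_smul, Fin.val_castSucc, Fin.val_last,
    smul_smul]
  have f6 : ∀ x : Fin m, X * (-1 : ℤ) ^ ((x : ℕ) + 1) = (-1 : ℤ) ^ ((x : ℕ) + 1) * X :=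
    fun x => mul_comm _ _
  have f7 : X * (-1 : ℤ) ^ (m + 1) = - ((-1 : ℤ) ^ m * X) := by ring
  have f8 : ∀ (x : Fin (n + 1)) (t : ℤ), (-1 : ℤ) ^ m * ((-1 : ℤ) ^ ((x : ℕ) + 1) * t) =
      (-1 : ℤ) ^ (m + (x : ℕ) + 1) * t := fun x t => by ring
  simp only [f6, f7, smul_eq_mul, f8, neg_smul]
  have f9 : a (fun i => g (Fin.cast rfl (Fin.castAdd n i)).succ) =
    a (fun i : Fin m => g (Fin.cast (show m + 1 + n = m + n + 1 by omega) (Fin.castAdd n i.succ))) := by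
    congr 1
  rw [f9]
  abel

/-- The cup product of two cocycles. -/
def cupCocycle {m n p : ℕ} (h : m + n = p) (a : Cocycle G A m) (b : Cocycle G ℤ n) :
    Cocycle G A p :=
  mkCocycle (cupFun h (val a) (val b)) (by
    rw [delta_cupFun, delta_val, delta_val]
    funext g
    simp [cupFun])

theorem cupFun_sub_left {m n p : ℕ} (h : m + n = p) (a a' : (Fin m → G) → A)
    (b : (Fin n → G) → ℤ) : cupFun h (a - a') b = cupFun h a b - cupFun h a' b := by
  funext g; simp [cupFun, smul_sub]

theorem cupFun_sub_right {m n p : ℕ} (h : m + n = p) (a : (Fin m → G) → A)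
    (b b' : (Fin n → G) → ℤ) : cupFun h a (b - b') = cupFun h a b - cupFun h a b' := by
  funext g; simp [cupFun, sub_smul]

theorem cls_eq_zero_of_val {n : ℕ} {z : Cocycle G A n} (h : val z = 0) : cls z = 0 := by
  have : z = 0 := val_injective (h.trans (map_zero
    (groupCohomology.iCocycles (Rep.trivial ℤ G A) n).hom).symm)
  rw [this]
  exact map_zero (groupCohomology.π (Rep.trivial ℤ G A) n).hom

theorem delta_smul {n : ℕ} (t : ℤ) (f : (Fin n → G) → A) : delta (t • f) = t • delta f :=
  map_smul (inhomogeneousCochains.d (Rep.trivial ℤ G A) n).hom t f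

theorem cls_cupCocycle_congr {m n p : ℕ} (h : m + n = p) {a a' : Cocycle G A m}
    {b b' : Cocycle G ℤ n} (ha : cls a = cls a') (hb : cls b = cls b') :
    cls (cupCocycle h a b) = cls (cupCocycle h a' b') := by
  have ha' : cls (a - a') = 0 := by rw [cls_sub, ha, sub_self]
  have hb' : cls (b - b') = 0 := by rw [cls_sub, hb, sub_self]
  have step1 : cls (cupCocycle h a b) = cls (cupCocycle h a' b) := by
    rw [← sub_eq_zero, ← cls_sub]
    have hv : val (cupCocycle h a b - cupCocycle h a' b) = cupFun h (val (a - a')) (val b) := by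
      rw [val_sub, val_sub, cupFun_sub_left]
      simp only [cupCocycle, val_mkCocycle]
    cases m with
    | zero =>
      apply cls_eq_zero_of_val
      rw [hv, cls_zero_degree ha']
      funext g; simp [cupFun]
    | succ m =>
      obtain ⟨p, rfl⟩ : ∃ q, p = q + 1 := ⟨m + n, by omega⟩
      obtain ⟨y, hy⟩ := (cls_succ_eq_zero_iff _).1 ha'
      refine (cls_succ_eq_zero_iff _).2 ⟨cupFun (show m + n = p by omega) y (val b), ?_⟩
      rw [hv, ← hy, delta_cupFun, delta_val]
      funext g; simp [cupFun]
  have step2 : cls (cupCocycle h a' b) = cls (cupCocycle h a' b') := by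
    rw [← sub_eq_zero, ← cls_sub]
    have hv : val (cupCocycle h a' b - cupCocycle h a' b') =
        cupFun h (val a') (val (b - b')) := by
      rw [val_sub, val_sub, cupFun_sub_right]
      simp only [cupCocycle, val_mkCocycle]
    cases n with
    | zero =>
      apply cls_eq_zero_of_val
      rw [hv, cls_zero_degree hb']
      funext g; simp [cupFun]
    | succ n =>
      obtain ⟨p, rfl⟩ : ∃ q, p = q + 1 := ⟨m + n, by omega⟩
      obtain ⟨y, hy⟩ := (cls_succ_eq_zero_iff _).1 hb'
      refine (cls_succ_eq_zero_iff _).2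
        ⟨(-1 : ℤ) ^ m • cupFun (show m + n = p by omega) (val a') y, ?_⟩
      rw [hv, ← hy, delta_smul, delta_cupFun, delta_val, smul_add, smul_smul, ← mul_pow]
      funext g; simp [cupFun]
  exact step1.trans step2

/-- A cocycle representing a given cohomology class. -/
def rep {n : ℕ} (x : Cohom G A n) : Cocycle G A n := Classical.choose (cls_surjective x)

theorem cls_rep {n : ℕ} (x : Cohom G A n) : cls (rep x) = x :=
  Classical.choose_spec (cls_surjective x)

/-- The cup product `H^m(G; A) × H^n(G; ℤ) → H^{m+n}(G; A)`, computed on representing cocycles;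
it does not depend on the representatives by `cup_cls`. The number `p` is a name for `m + n`. -/
def cup {m n p : ℕ} (h : m + n = p) (x : Cohom G A m) (y : Cohom G ℤ n) : Cohom G A p :=
  cls (cupCocycle h (rep x) (rep y))

theorem cup_cls {m n p : ℕ} (h : m + n = p) (a : Cocycle G A m) (b : Cocycle G ℤ n) :
    cup h (cls a) (cls b) = cls (cupCocycle h a b) :=
  cls_cupCocycle_congr h (cls_rep _) (cls_rep _)

/-- The constant `0`-cocycle `1`, which represents the unit of `H^*(G; ℤ)`. -/
def oneCocycle (G : Type) [Group G] : Cocycle G ℤ 0 :=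
  mkCocycle (fun _ => 1) (by funext g; simp [delta_apply])

/-- The cup power `c^k` of an integral `2`-cocycle `c`. -/
def cocyclePow (c : Cocycle G ℤ 2) : (k : ℕ) → Cocycle G ℤ (2 * k)
  | 0 => oneCocycle G
  | k + 1 => cupCocycle (show 2 * k + 2 = 2 * (k + 1) by omega) (cocyclePow c k) c

/-- The cup power `x^k ∈ H^{2k}(G; ℤ)` of a class `x ∈ H^2(G; ℤ)`. -/
def cupPow (x : Cohom G ℤ 2) : (k : ℕ) → Cohom G ℤ (2 * k)
  | 0 => cls (oneCocycle G)
  | k + 1 => cup (show 2 * k + 2 = 2 * (k + 1) by omega) (cupPow x k) x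

theorem cupPow_cls (c : Cocycle G ℤ 2) (k : ℕ) : cupPow (cls c) k = cls (cocyclePow c k) := by
  induction k with
  | zero => rfl
  | succ k ih => rw [cupPow, ih, cup_cls, cocyclePow]

theorem linearCombination_d {n : ℕ} (f : (Fin n → G) → A) (s : (Fin (n + 1) → G) →₀ ℤ) :
    Finsupp.linearCombination ℤ f (groupHomology.inhomogeneousChains.d (Rep.trivial ℤ G ℤ) n s) =
      Finsupp.linearCombination ℤ (delta f) s := by
  induction s using Finsupp.induction_linear with
  | zero => simp
  | add s t hs ht => rw [map_add, map_add, map_add, hs, ht]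
  | single g t =>
    erw [groupHomology.inhomogeneousChains.d_single]
    rw [map_add, map_sum, Finsupp.linearCombination_single]
    erw [Finsupp.linearCombination_single]
    rw [delta_apply, smul_add, Finset.smul_sum]
    congr 1
    · refine Finset.sum_congr rfl fun j _ => ?_
      erw [map_smul, Finsupp.linearCombination_single]
      rw [smul_comm]

/-- Evaluation of an `n`-cocycle on homology classes: the class of a cycle `∑ nᵢ [gᵢ]`, with
`gᵢ ∈ G^n`, is sent to `∑ nᵢ z(gᵢ)`. -/
def evalCocycle {n : ℕ} (z : Cocycle G A n) : Homol G n →+ A :=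
  ((groupHomology.inhomogeneousChains (Rep.trivial ℤ G ℤ)).homologyι n ≫
    (groupHomology.inhomogeneousChains (Rep.trivial ℤ G ℤ)).descOpcycles
      (A := ModuleCat.of ℤ A) (ModuleCat.ofHom (Finsupp.linearCombination ℤ (val z))) (n + 1)
      (by simp) (by
        rw [groupHomology.inhomogeneousChains.d_def]
        ext1
        refine LinearMap.ext fun s => ?_
        refine (linearCombination_d (val z) s).trans ?_
        rw [delta_val]
        simp)).hom.toAddMonoidHom

theorem evalCocycle_π {n : ℕ} (z : Cocycle G A n)
    (s : groupHomology.cycles (Rep.trivial ℤ G ℤ) n) :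
    evalCocycle z (groupHomology.π (Rep.trivial ℤ G ℤ) n s) =
      Finsupp.linearCombination ℤ (val z) (groupHomology.iCycles (Rep.trivial ℤ G ℤ) n s) := by
  let K := groupHomology.inhomogeneousChains (Rep.trivial ℤ G ℤ)
  have h : ∀ φ : K.opcycles n ⟶ ModuleCat.of ℤ A,
      K.homologyπ n ≫ K.homologyι n ≫ φ = K.iCycles n ≫ K.pOpcycles n ≫ φ := by
    intro φ
    rw [← Category.assoc, K.homology_π_ι, Category.assoc]
  refine (congrArg (fun φ => φ.hom s) (h _)).trans ?_
  rw [HomologicalComplex.p_descOpcycles]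
  rfl

/-- The Kronecker pairing `H^n(G; A) × H_n(G; ℤ) → A`; it may be computed from any representing
cocycle by `pairing_cls`. -/
def pairing {n : ℕ} (x : Cohom G A n) : Homol G n →+ A := evalCocycle (rep x)

theorem pairing_cls {n : ℕ} (z : Cocycle G A n) : pairing (cls z) = evalCocycle z := by
  ext σ
  refine groupHomology_induction_on (A := Rep.trivial ℤ G ℤ) σ fun s => ?_
  erw [pairing, evalCocycle_π, evalCocycle_π]
  have h0 : cls (rep (cls z) - z) = 0 := by rw [cls_sub, cls_rep, sub_self]
  have hs : val (rep (cls z)) = val z + val (rep (cls z) - z) := by rw [val_sub]; abel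
  rw [hs]
  cases n with
  | zero => rw [cls_zero_degree h0, add_zero]
  | succ n =>
    obtain ⟨y, hy⟩ := (cls_succ_eq_zero_iff _).1 h0
    have hd : groupHomology.inhomogeneousChains.d (Rep.trivial ℤ G ℤ) n
        (groupHomology.iCycles (Rep.trivial ℤ G ℤ) (n + 1) s) = 0 := by
      rw [← groupHomology.inhomogeneousChains.d_def]
      exact congrArg (fun φ => φ.hom s)
        ((groupHomology.inhomogeneousChains (Rep.trivial ℤ G ℤ)).iCycles_d (n + 1) n)
    have := linearCombination_d y (groupHomology.iCycles (Rep.trivial ℤ G ℤ) (n + 1) s)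
    rw [hd, map_zero, hy] at this
    rw [Finsupp.linearCombination_apply, Finsupp.linearCombination_apply] at *
    simp only [Pi.add_apply, smul_add, Finsupp.sum_add]
    erw [← this, add_zero]

/-- The map `f_* : H_n(G; ℤ) → H_n(H; ℤ)` induced by a group homomorphism `f : G → H`. -/
def homolMap (f : G →* H) (n : ℕ) : Homol G n →+ Homol H n :=
  (groupHomology.map (A := Rep.trivial ℤ G ℤ) (B := Rep.trivial ℤ H ℤ) f
    (Rep.ofHom ⟨LinearMap.id, fun _ => rfl⟩) n).hom.toAddMonoidHom

/-- The map `f^* : H^n(H; A) → H^n(G; A)` induced by a group homomorphism `f : G → H`. -/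
def pullback (f : G →* H) (n : ℕ) : Cohom H A n →+ Cohom G A n :=
  (groupCohomology.map (A := Rep.trivial ℤ H A) (B := Rep.trivial ℤ G A) f
    (Rep.ofHom ⟨LinearMap.id, fun _ => rfl⟩) n).hom.toAddMonoidHom

/-- The map `H^n(G; A) → H^n(G; B)` induced by a homomorphism `A → B` of coefficients. -/
def coeffMap (φ : A →+ B) (n : ℕ) : Cohom G A n →+ Cohom G B n :=
  (groupCohomology.map (A := Rep.trivial ℤ G A) (B := Rep.trivial ℤ G B) (MonoidHom.id G)
    (Rep.ofHom ⟨φ.toIntLinearMap, fun _ => rfl⟩) n).hom.toAddMonoidHom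

/-- The group `ℚ/ℤ`. -/
abbrev QModZ : Type := ℚ ⧸ AddSubgroup.zmultiples (1 : ℚ)

end

end GroupClasses

namespace CircleDiff

open GroupClasses
open scoped Manifold ContDiff

/-- The universal covering `ℝ → S¹`, `t ↦ exp(2πit)`, whose deck transformations are the integer
translations. -/
def circleParam (t : ℝ) : Circle := Circle.exp (2 * Real.pi * t)

/-- `F` is a lift to `ℝ` of the circle homeomorphism `f`. The units of `CircleDeg1Lift` are the
increasing bijections `F` of `ℝ` with `F(t + 1) = F(t) + 1`. -/
def IsLift (F : CircleDeg1Liftˣ) (f : Circle ≃ₜ Circle) : Prop :=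
  ∀ t : ℝ, f (circleParam t) = circleParam (F t)

theorem circleParam_eq_iff {s t : ℝ} :
    circleParam s = circleParam t ↔ ∃ m : ℤ, s = t + m := by
  have hp : (2 * Real.pi : ℝ) ≠ 0 := by positivity
  rw [circleParam, circleParam, Circle.exp_eq_exp]
  refine exists_congr fun m => ⟨fun h => mul_left_cancel₀ hp (by linarith), fun h => by rw [h]; ring⟩

theorem IsLift.mul {F F' : CircleDeg1Liftˣ} {f f' : Circle ≃ₜ Circle} (h : IsLift F f)
    (h' : IsLift F' f') : IsLift (F * F') (f * f') := fun t => by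
  change f (f' (circleParam t)) = circleParam (F (F' t))
  rw [h' t, h]

theorem IsLift.inv {F : CircleDeg1Liftˣ} {f : Circle ≃ₜ Circle} (h : IsLift F f) :
    IsLift F⁻¹ f⁻¹ := fun t => by
  have := h ((F⁻¹ : CircleDeg1Liftˣ) t)
  rw [CircleDeg1Lift.units_apply_inv_apply] at this
  rw [← this]
  exact f.symm_apply_apply _

/-- The group `Diff₊ S¹` of orientation preserving `C^∞` diffeomorphisms of the circle, as an
abstract (discrete) group. A homeomorphism preserves the orientation if and only if it has an
increasing lift to `ℝ`. The lifts of elements of this group form its universal covering group. -/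
def DiffPlus : Subgroup (Circle ≃ₜ Circle) where
  carrier := {f | ContMDiff (𝓡 1) (𝓡 1) ∞ f ∧ ContMDiff (𝓡 1) (𝓡 1) ∞ f.symm ∧ ∃ F, IsLift F f}
  mul_mem' := by
    rintro f g ⟨hf, hf', F, hF⟩ ⟨hg, hg', G, hG⟩
    exact ⟨hf.comp hg, hg'.comp hf', F * G, hF.mul hG⟩
  one_mem' := ⟨contMDiff_id, contMDiff_id, 1, fun _ => rfl⟩
  inv_mem' := by
    rintro f ⟨hf, hf', F, hF⟩
    exact ⟨hf', hf, F⁻¹, hF.inv⟩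

/-- The rotation `z ↦ a z` of the circle. -/
def rotation : Circle →* DiffPlus where
  toFun a := ⟨Homeomorph.mulLeft a, contMDiff_mul_left, contMDiff_mul_left, by
    obtain ⟨s, hs⟩ : ∃ s, circleParam s = a := by
      obtain ⟨s, hs⟩ := Circle.exp_surjective a
      refine ⟨s / (2 * Real.pi), ?_⟩
      rw [circleParam, mul_div_cancel₀ _ (by positivity), hs]
    refine ⟨CircleDeg1Lift.translate (Multiplicative.ofAdd s), fun t => ?_⟩
    rw [CircleDeg1Lift.translate_apply, ← hs]
    simp only [Homeomorph.coe_mulLeft, circleParam, mul_add, Circle.exp_add]⟩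
  map_one' := Subtype.ext (Homeomorph.ext fun z => one_mul z)
  map_mul' a b := Subtype.ext (Homeomorph.ext fun z => mul_assoc a b z)

/-- The subgroup `SO(2)` of rotations. -/
def SO2 : Subgroup DiffPlus := rotation.range

/-- The torsion subgroup of `SO(2)`, that is the group of rational rotations. -/
def SO2tor : Subgroup DiffPlus := (CommGroup.torsion Circle).map rotation

theorem SO2tor_le_SO2 : SO2tor ≤ SO2 := Subgroup.map_le_range _ _

/-- A set theoretic section of the central extension of `Diff₊ S¹` by `ℤ` whose total space is the
universal covering group: a chosen lift of each diffeomorphism. -/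
def lift (f : DiffPlus) : CircleDeg1Liftˣ := Classical.choose f.2.2.2

theorem isLift_lift (f : DiffPlus) : IsLift (lift f) f := Classical.choose_spec f.2.2.2

theorem IsLift.eq_translate_mul {F F' : CircleDeg1Liftˣ} {f : Circle ≃ₜ Circle}
    (h : IsLift F f) (h' : IsLift F' f) :
    ∃ n : ℤ, F = CircleDeg1Lift.translate (Multiplicative.ofAdd (n : ℝ)) * F' := by
  have hD : ∀ t : ℝ, ∃ m : ℤ, (F * F'⁻¹ : CircleDeg1Liftˣ) t = t + m := fun t => by
    rw [← circleParam_eq_iff]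
    have := (h.mul h'.inv) t
    rw [mul_inv_cancel] at this
    exact this.symm
  set D : CircleDeg1Liftˣ := F * F'⁻¹ with hDdef
  choose m hm using hD
  have hconst : ∀ t ∈ Set.Ico (0 : ℝ) 1, m t = m 0 := fun t ht => by
    have h1 : D 0 ≤ D t := (D : CircleDeg1Lift).monotone ht.1
    have h2 : D t < D (0 + 1) := by
      have : StrictMono (D : CircleDeg1Lift) := (CircleDeg1Lift.toOrderIso D).strictMono
      exact this (by linarith [ht.2])
    rw [CircleDeg1Lift.map_add_one] at h2
    rw [hm, hm] at h1 h2
    have a1 : (m 0 : ℝ) < m t + 1 := by linarith [ht.2]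
    have a2 : (m t : ℝ) < m 0 + 1 := by linarith [ht.1]
    norm_cast at a1 a2
    omega
  refine ⟨m 0, ?_⟩
  have hall : D = CircleDeg1Lift.translate (Multiplicative.ofAdd (m 0 : ℝ)) := by
    apply Units.ext
    ext t
    have hf := hconst (Int.fract t) ⟨Int.fract_nonneg t, Int.fract_lt_one t⟩
    have h3 := hm (Int.fract t)
    rw [hf] at h3
    conv_lhs => rw [← Int.fract_add_floor t, CircleDeg1Lift.map_add_int, h3]
    rw [CircleDeg1Lift.translate_apply]
    linarith [Int.fract_add_floor t]
  rw [← hall, hDdef, inv_mul_cancel_right]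

theorem exists_eulerCochain (f g : DiffPlus) : ∃ n : ℤ, lift f * lift g =
    CircleDeg1Lift.translate (Multiplicative.ofAdd (n : ℝ)) * lift (f * g) :=
  ((isLift_lift f).mul (isLift_lift g)).eq_translate_mul (isLift_lift (f * g))

/-- The `2`-cocycle of the central extension by `ℤ` of `Diff₊ S¹` that belongs to the section
`lift`: the integer `n` with `lift f * lift g = T^n * lift (f * g)`, where `T(t) = t + 1`. -/
def eulerFun (f g : DiffPlus) : ℤ := Classical.choose (exists_eulerCochain f g)

theorem eulerFun_spec (f g : DiffPlus) : lift f * lift g =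
    CircleDeg1Lift.translate (Multiplicative.ofAdd (eulerFun f g : ℝ)) * lift (f * g) :=
  Classical.choose_spec (exists_eulerCochain f g)

theorem eulerFun_cocycle (f g h : DiffPlus) :
    eulerFun g h - eulerFun (f * g) h + eulerFun f (g * h) - eulerFun f g = 0 := by
  have key : ∀ (a b : DiffPlus) (t : ℝ), lift a (lift b t) = eulerFun a b + lift (a * b) t :=
    fun a b t => congrArg (fun U : CircleDeg1Liftˣ => U t) (eulerFun_spec a b)
  have e1 : lift f (lift g (lift h 0)) =
      eulerFun f g + (eulerFun (f * g) h + lift (f * g * h) 0) := by rw [key, key]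
  have e2 : lift f (lift g (lift h 0)) =
      eulerFun g h + (eulerFun f (g * h) + lift (f * (g * h)) 0) := by
    rw [key g h, CircleDeg1Lift.map_int_add, key]
  rw [mul_assoc] at e1
  have : (eulerFun g h - eulerFun (f * g) h + eulerFun f (g * h) - eulerFun f g : ℝ) = 0 := by
    linarith
  exact_mod_cast this

/-- The Euler class `χ ∈ H²(Diff₊ S¹; ℤ)` of the discrete group `Diff₊ S¹`: the class of the
central extension by `ℤ` given by the universal covering group. -/
def eulerClass : Cohom DiffPlus ℤ 2 :=
  cls (mkCocycle (fun g : Fin 2 → DiffPlus => eulerFun (g 0) (g 1)) (by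
    funext g
    have h := eulerFun_cocycle (g 0) (g 1) (g 2)
    rw [delta_apply, Fin.sum_univ_three]
    simp [Fin.contractNth]
    linarith))

/-- The restriction of the Euler class to a subgroup of `Diff₊ S¹`. -/
def eulerClassOn (Γ : Subgroup DiffPlus) : Cohom Γ ℤ 2 := pullback Γ.subtype 2 eulerClass

/-- `χ^k = 0` in `H^{2k}(Γ; ℚ)`. -/
def RationalEulerPowVanishes (Γ : Subgroup DiffPlus) (k : ℕ) : Prop :=
  coeffMap (Int.castAddHom ℚ) (2 * k) (cupPow (eulerClassOn Γ) k) = 0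

/-- `x ∈ H^{2k-1}(Γ; ℚ/ℤ)` is a secondary class for `χ^k` (where `k ≥ 1`): there are an integral
cocycle `c` representing `χ` and a rational cochain `a` with `δ a = c^k` such that `x` is the class
of the reduction of `a` modulo `ℤ`. -/
def IsSecondaryClass (Γ : Subgroup DiffPlus) (k : ℕ) (x : Cohom Γ QModZ (2 * k - 1)) : Prop :=
  ∃ (c : Cocycle Γ ℤ 2) (a : (Fin (2 * k - 1) → Γ) → ℚ) (z : Cocycle Γ QModZ (2 * k - 1)),
    cls c = eulerClassOn Γ ∧
    ((groupCohomology.inhomogeneousCochains (Rep.trivial ℤ Γ ℚ)).d (2 * k - 1) (2 * k) a :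
      (Fin (2 * k) → Γ) → ℚ) = (fun g => ((val (cocyclePow c k) g : ℤ) : ℚ)) ∧
    val z = (fun g => QuotientAddGroup.mk (a g)) ∧
    cls z = x

/-- The inclusion `i` of the rational rotations into a group `Γ` that contains `SO(2)`. -/
def torInclusion {Γ : Subgroup DiffPlus} (h : SO2 ≤ Γ) : SO2tor →* Γ :=
  Subgroup.inclusion (SO2tor_le_SO2.trans h)

end CircleDiff

end

noncomputable section

namespace GroupClasses

open CategoryTheory

/-! On the rational rotations every lift to the line is a translation by a rational number, so the
Euler cocycle is the coboundary of a rational 1-cochain `u`, and `u` modulo `ℤ` is an isomorphism of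
`SO2tor` with `ℚ/ℤ`. Call its class `x`. The heart of the proof is
`IsPrimitive.cupPowEval_bijective`: pairing with `x ∪ χ^j` identifies `H_{2j+1}(SO2tor; ℤ)` with
`ℚ/ℤ`. A cycle involves finitely many rotations, hence lives on a finite cyclic subgroup of some
order N. There the odd homology is cyclic and killed by N, and an explicit cycle `fundCycle` has
pairing `1/N` modulo `ℤ`; this forces injectivity, and multiples of such values give all of `ℚ/ℤ`.

For (i), the cap product with `χ` lowers the degree by two, commutes with `i_*`, and turns the
pairing with `x ∪ χ^{j+1}` into the pairing with `x ∪ χ^j`. Since both pairings are bijective, the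
cap product is an isomorphism on the odd homology of `SO2tor`. A kernel element in a higher degree
is thus carried to a kernel element in a lower one, and if `i_*` vanishes in a higher degree it
vanishes below.

For (ii), let `δ a = c^k`. Restricted to `SO2tor`, the cochains `a ∪ c^{l-k}` and `u ∪ c^{l-1}` both
have coboundary `c^l`, so they differ by a rational cocycle. This cocycle evaluates to zero, the odd
homology being torsion. Modulo `ℤ` the secondary class therefore gives the same pairing as `x ∪
χ^{l-1}`, which is bijective (`IsPrimitive.evalCocycle_secondary`). Since this pairing factors
through `i_*`, injectivity follows.

Identities between chains are obtained by duality: a chain is determined by its values under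
integral cochains (`chain_ext`), so each reduces to a formula for `delta`. -/

/-- The group of inhomogeneous integral `n`-chains of `G`. -/
abbrev Chain (G : Type) (n : ℕ) : Type := (Fin n → G) →₀ ℤ

/-! ### Chains, evaluation and classes of cycles. -/

section
variable {G H : Type} [Group G] [Group H] {A B : Type} [AddCommGroup A] [AddCommGroup B]

/-- The boundary `C_{n+1}(G; ℤ) → C_n(G; ℤ)` of inhomogeneous chains. -/
def boundary {n : ℕ} : Chain G (n + 1) →ₗ[ℤ] Chain G n :=
  (groupHomology.inhomogeneousChains.d (Rep.trivial ℤ G ℤ) n).hom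

/-- The evaluation of a cochain on a chain. -/
def eval {n : ℕ} (f : (Fin n → G) → A) : Chain G n →ₗ[ℤ] A := Finsupp.linearCombination ℤ f

theorem eval_single {n : ℕ} (f : (Fin n → G) → A) (g : Fin n → G) (t : ℤ) :
    eval f (Finsupp.single g t) = t • f g := Finsupp.linearCombination_single ℤ t g

theorem eval_boundary {n : ℕ} (f : (Fin n → G) → A) (s : Chain G (n + 1)) :
    eval f (boundary s) = eval (delta f) s := linearCombination_d f s

theorem eval_add {n : ℕ} (f f' : (Fin n → G) → A) (s : Chain G n) :
    eval (f + f') s = eval f s + eval f' s := by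
  simp [eval, Finsupp.linearCombination_apply, Finsupp.sum_add]

theorem eval_sub {n : ℕ} (f f' : (Fin n → G) → A) (s : Chain G n) :
    eval (f - f') s = eval f s - eval f' s := by
  rw [eq_sub_iff_add_eq, ← eval_add, sub_add_cancel]

theorem eval_comp {n : ℕ} (φ : A →+ B) (f : (Fin n → G) → A) (s : Chain G n) :
    eval (fun g => φ (f g)) s = φ (eval f s) := by
  simp [eval, Finsupp.linearCombination_apply, map_finsuppSum]

theorem eval_zero {n : ℕ} (s : Chain G n) : eval (0 : (Fin n → G) → A) s = 0 := by
  simp [eval]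

/-- Chains are separated by integral cochains. -/
theorem chain_ext {n : ℕ} {s t : Chain G n} (h : ∀ f : (Fin n → G) → ℤ, eval f s = eval f t) :
    s = t := by
  classical
  ext g
  have key : ∀ u : Chain G n, eval (Pi.single g (1 : ℤ)) u = u g := fun u => by
    simp +contextual [eval, Finsupp.linearCombination_apply, Pi.single_apply, eq_comm]
  rw [← key, ← key, h]

/-- The homology class of a cycle of positive degree. -/
def homolCls {n : ℕ} (z : Chain G (n + 1)) (hz : boundary z = 0) : Homol G (n + 1) :=
  groupHomology.π (Rep.trivial ℤ G ℤ) (n + 1)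
    (groupHomology.cyclesMk (A := Rep.trivial ℤ G ℤ) (n + 1) n (by simp) z (by
      rw [groupHomology.inhomogeneousChains.d_def]; exact hz))

theorem homolCls_surjective {n : ℕ} (σ : Homol G (n + 1)) :
    ∃ (z : Chain G (n + 1)) (hz : boundary z = 0), homolCls z hz = σ := by
  refine groupHomology_induction_on (A := Rep.trivial ℤ G ℤ) σ fun s => ?_
  have hd : boundary (groupHomology.iCycles (Rep.trivial ℤ G ℤ) (n + 1) s : Chain G (n + 1)) =
      0 := by
    change groupHomology.inhomogeneousChains.d (Rep.trivial ℤ G ℤ) n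
        (groupHomology.iCycles (Rep.trivial ℤ G ℤ) (n + 1) s) = 0
    rw [← groupHomology.inhomogeneousChains.d_def]
    exact congrArg (fun φ => φ.hom s)
      ((groupHomology.inhomogeneousChains (Rep.trivial ℤ G ℤ)).iCycles_d (n + 1) n)
  refine ⟨_, hd, ?_⟩
  refine congrArg (groupHomology.π (Rep.trivial ℤ G ℤ) (n + 1)) ?_
  refine (ModuleCat.mono_iff_injective (groupHomology.iCycles (Rep.trivial ℤ G ℤ) (n + 1))).1
    inferInstance ?_
  exact groupHomology.iCycles_mk (A := Rep.trivial ℤ G ℤ) _ _ _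

theorem homolCls_eq_zero_iff {n : ℕ} {z : Chain G (n + 1)} (hz : boundary z = 0) :
    homolCls z hz = 0 ↔ ∃ t : Chain G (n + 2), boundary t = z := by
  set K := groupHomology.inhomogeneousChains (Rep.trivial ℤ G ℤ) with hK
  have ex := ShortComplex.exact_of_g_is_cokernel
    (ShortComplex.mk _ _ (K.toCycles_comp_homologyπ (n + 2) (n + 1)))
    (K.homologyIsCokernel (n + 2) (n + 1) (by simp))
  rw [ShortComplex.moduleCat_exact_iff] at ex
  have key : ∀ y : Chain G (n + 2), boundary y = K.iCycles (n + 1) (K.toCycles (n + 2) (n + 1) y) :=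
    fun y => by
      change groupHomology.inhomogeneousChains.d (Rep.trivial ℤ G ℤ) (n + 1) y = _
      rw [← groupHomology.inhomogeneousChains.d_def]
      exact (congrArg (fun φ => φ.hom y) (K.toCycles_i (n + 2) (n + 1))).symm
  constructor
  · intro h
    obtain ⟨y, hy⟩ := ex _ h
    refine ⟨y, (key y).trans ((congrArg (K.iCycles (n + 1)) hy).trans ?_)⟩
    exact groupHomology.iCycles_mk (A := Rep.trivial ℤ G ℤ) _ _ _
  · rintro ⟨y, hy⟩
    have : groupHomology.cyclesMk (A := Rep.trivial ℤ G ℤ) (n + 1) n (by simp) z (by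
      rw [groupHomology.inhomogeneousChains.d_def]; exact hz) = K.toCycles (n + 2) (n + 1) y := by
      refine (ModuleCat.mono_iff_injective (K.iCycles (n + 1))).1 inferInstance ?_
      refine Eq.trans ?_ (hy.symm.trans (key y))
      exact groupHomology.iCycles_mk (A := Rep.trivial ℤ G ℤ) _ _ _
    rw [homolCls, this]
    exact congrArg (fun φ => φ.hom y) (K.toCycles_comp_homologyπ (n + 2) (n + 1))

theorem evalCocycle_homolCls {n : ℕ} (x : Cocycle G A (n + 1)) {z : Chain G (n + 1)}
    (hz : boundary z = 0) : evalCocycle x (homolCls z hz) = eval (val x) z := by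
  refine (evalCocycle_π x _).trans (congrArg (eval (val x)) ?_)
  exact groupHomology.iCycles_mk (A := Rep.trivial ℤ G ℤ) _ _ _

/-! ### Functoriality on chains. -/

/-- The chain map induced by a map of groups. -/
def chainMap (f : G → H) (n : ℕ) : Chain G n →ₗ[ℤ] Chain H n :=
  Finsupp.lmapDomain ℤ ℤ fun g => f ∘ g

theorem chainMap_single (f : G → H) {n : ℕ} (g : Fin n → G) (t : ℤ) :
    chainMap f n (Finsupp.single g t) = Finsupp.single (f ∘ g) t := Finsupp.mapDomain_single

theorem eval_chainMap (f : G → H) {n : ℕ} (a : (Fin n → H) → A) (s : Chain G n) :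
    eval a (chainMap f n s) = eval (fun g => a (f ∘ g)) s := by
  induction s using Finsupp.induction_linear with
  | zero => simp
  | add s t hs ht => simp only [map_add, hs, ht]
  | single g t => rw [chainMap_single, eval_single, eval_single]

theorem delta_comp (f : G →* H) {n : ℕ} (a : (Fin n → H) → A) :
    delta (fun g => a (f ∘ g)) = fun g => delta a (f ∘ g) := by
  funext g
  simp only [delta_apply]
  congr 1
  refine Finset.sum_congr rfl fun j _ => ?_
  congr 2
  funext i
  simp only [Function.comp_apply, Fin.contractNth]
  split_ifs <;> simp

theorem boundary_chainMap (f : G →* H) {n : ℕ} (s : Chain G (n + 1)) :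
    boundary (chainMap f (n + 1) s) = chainMap f n (boundary s) :=
  chain_ext fun a => by
    rw [eval_boundary, eval_chainMap, eval_chainMap, eval_boundary, delta_comp]

theorem homolMap_homolCls (f : G →* H) {n : ℕ} {z : Chain G (n + 1)} (hz : boundary z = 0) :
    homolMap f (n + 1) (homolCls z hz) =
      homolCls (chainMap f (n + 1) z) (by rw [boundary_chainMap, hz, map_zero]) := by
  let φ : Rep.trivial ℤ G ℤ ⟶ Rep.res f (Rep.trivial ℤ H ℤ) :=
    Rep.ofHom ⟨LinearMap.id, fun _ => rfl⟩
  refine (congrArg (fun ψ => ψ.hom (groupHomology.cyclesMk (A := Rep.trivial ℤ G ℤ) (n + 1) n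
    (by simp) z (by rw [groupHomology.inhomogeneousChains.d_def]; exact hz)))
    (groupHomology.π_map (A := Rep.trivial ℤ G ℤ) (B := Rep.trivial ℤ H ℤ) f φ (n + 1))).trans ?_
  refine congrArg (groupHomology.π (Rep.trivial ℤ H ℤ) (n + 1)) ?_
  refine (ModuleCat.mono_iff_injective (groupHomology.iCycles (Rep.trivial ℤ H ℤ) (n + 1))).1
    inferInstance ?_
  refine Eq.trans ?_ (groupHomology.iCycles_mk (A := Rep.trivial ℤ H ℤ) _ _ _).symm
  refine (congrArg (fun ψ => ψ.hom (groupHomology.cyclesMk (A := Rep.trivial ℤ G ℤ) (n + 1) n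
    (by simp) z (by rw [groupHomology.inhomogeneousChains.d_def]; exact hz)))
    (HomologicalComplex.cyclesMap_i (groupHomology.chainsMap (A := Rep.trivial ℤ G ℤ)
      (B := Rep.trivial ℤ H ℤ) f φ) (n + 1))).trans ?_
  refine (congrArg ((groupHomology.chainsMap (A := Rep.trivial ℤ G ℤ)
      (B := Rep.trivial ℤ H ℤ) f φ).f (n + 1))
      (groupHomology.iCycles_mk (A := Rep.trivial ℤ G ℤ) _ _ _)).trans ?_
  -- From here on the cycle condition plays no role: two linear maps on chains are compared on basis
  -- elements.
  generalize z = y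
  change ((groupHomology.chainsMap (A := Rep.trivial ℤ G ℤ)
      (B := Rep.trivial ℤ H ℤ) f φ).f (n + 1)).hom y = _
  induction y using Finsupp.induction_linear with
  | zero => exact (map_zero _).trans (map_zero _).symm
  | add s t hs ht => erw [map_add, map_add, hs, ht]
  | single g t =>
    rw [chainMap_single]
    exact groupHomology.chainsMap_f_single (A := Rep.trivial ℤ G ℤ) (B := Rep.trivial ℤ H ℤ)
      f φ (n + 1) g t

/-! ### Cup powers at the cochain level, and cap products. -/

theorem cupFun_assoc {m n k p q r : ℕ} (h₁ : m + n = p) (h₂ : p + k = r) (h₃ : n + k = q)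
    (h₄ : m + q = r) (a : (Fin m → G) → A) (b : (Fin n → G) → ℤ) (c : (Fin k → G) → ℤ) :
    cupFun h₂ (cupFun h₁ a b) c = cupFun h₄ a (cupFun h₃ b c) := by
  subst h₁ h₂ h₃
  funext g
  have e : ∀ j : Fin k, Fin.cast h₄ (Fin.natAdd m (Fin.natAdd n j)) = Fin.natAdd (m + n) j :=
    fun j => by ext; simp; omega
  simp only [cupFun, Fin.cast_refl, id, smul_smul, smul_eq_mul, e]
  rfl

theorem cupFun_comp {m n p : ℕ} (h : m + n = p) (a : (Fin m → H) → A) (b : (Fin n → H) → ℤ)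
    (f : G → H) :
    (fun g : Fin p → G => cupFun h a b (f ∘ g)) =
      cupFun h (fun g => a (f ∘ g)) (fun g => b (f ∘ g)) := rfl

theorem cupFun_map {m n p : ℕ} (h : m + n = p) (φ : A →+ B) (a : (Fin m → G) → A)
    (b : (Fin n → G) → ℤ) :
    (fun g : Fin p → G => φ (cupFun h a b g)) = cupFun h (fun g => φ (a g)) b := by
  funext g
  simp [cupFun]

theorem delta_map (φ : A →+ B) {n : ℕ} (a : (Fin n → G) → A) :
    delta (fun g => φ (a g)) = fun g => φ (delta a g) := by
  funext g
  simp [delta_apply]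

theorem delta_sub {n : ℕ} (a b : (Fin n → G) → A) : delta (a - b) = delta a - delta b :=
  map_sub (inhomogeneousCochains.d (Rep.trivial ℤ G A) n).hom a b

/-- The restriction of a cocycle along a group homomorphism. -/
def Cocycle.comp {n : ℕ} (c : Cocycle H A n) (f : G →* H) : Cocycle G A n :=
  mkCocycle (fun g => val c (f ∘ g)) (by rw [delta_comp, delta_val]; rfl)

theorem val_comp {n : ℕ} (c : Cocycle H A n) (f : G →* H) :
    val (Cocycle.comp c f) = fun g => val c (f ∘ g) := val_mkCocycle _ _

theorem val_cupCocycle {m n p : ℕ} (h : m + n = p) (a : Cocycle G A m) (b : Cocycle G ℤ n) :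
    val (cupCocycle h a b) = cupFun h (val a) (val b) := val_mkCocycle _ _

theorem val_cocyclePow_succ (c : Cocycle G ℤ 2) (k : ℕ) :
    val (cocyclePow c (k + 1)) = cupFun (by omega) (val (cocyclePow c k)) (val c) :=
  val_cupCocycle _ _ _

theorem val_cocyclePow_comp (c : Cocycle H ℤ 2) (f : G →* H) (k : ℕ) :
    val (cocyclePow (Cocycle.comp c f) k) = fun g => val (cocyclePow c k) (f ∘ g) := by
  induction k with
  | zero =>
    have e : ∀ (K : Type) [Group K], val (oneCocycle K) = fun _ => 1 := fun K _ =>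
      val_mkCocycle _ _
    simp only [cocyclePow]
    rw [e, e]
  | succ k ih => rw [val_cocyclePow_succ, val_cocyclePow_succ, ih, val_comp, cupFun_comp]

theorem cupFun_cocyclePow_zero {m p : ℕ} (h : m + 2 * 0 = p) (a : (Fin m → G) → A)
    (c : Cocycle G ℤ 2) :
    cupFun h a (val (cocyclePow c 0)) = fun g => a (fun i => g (Fin.cast h i)) := by
  funext g
  rw [cupFun, cocyclePow, oneCocycle, val_mkCocycle, one_smul]
  rfl

theorem cupFun_cocyclePow_succ {m p q : ℕ} (k : ℕ) (h : m + 2 * (k + 1) = q) (h' : m + 2 * k = p)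
    (h'' : p + 2 = q) (a : (Fin m → G) → A) (c : Cocycle G ℤ 2) :
    cupFun h a (val (cocyclePow c (k + 1))) =
      cupFun h'' (cupFun h' a (val (cocyclePow c k))) (val c) := by
  rw [val_cocyclePow_succ, cupFun_assoc]

/-- Associativity is strict for inhomogeneous cochains, so powers can be split without passing to
cohomology. -/
theorem cupFun_cocyclePow_add {m p q : ℕ} (j k : ℕ) (h : m + 2 * (j + k) = q) (h' : m + 2 * j = p)
    (h'' : p + 2 * k = q) (a : (Fin m → G) → A) (c : Cocycle G ℤ 2) :
    cupFun h a (val (cocyclePow c (j + k))) =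
      cupFun h'' (cupFun h' a (val (cocyclePow c j))) (val (cocyclePow c k)) := by
  induction k generalizing q with
  | zero =>
    rw [cupFun_cocyclePow_zero]
    subst h' h''
    rfl
  | succ k ih =>
    have h1 : p + 2 * k + 2 = q := by omega
    rw [cupFun_cocyclePow_succ k h'' rfl h1, ← ih (by omega) rfl]
    exact cupFun_cocyclePow_succ (j + k) h (by omega) h1 a c

/-- The cap product with a cochain. -/
def cap {m n p : ℕ} (h : m + n = p) (b : (Fin n → G) → ℤ) : Chain G p →ₗ[ℤ] Chain G m :=
  eval fun g => Finsupp.single (fun i => g (Fin.cast h (Fin.castAdd n i)))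
    (b fun j => g (Fin.cast h (Fin.natAdd m j)))

theorem eval_cap {m n p : ℕ} (h : m + n = p) (a : (Fin m → G) → A) (b : (Fin n → G) → ℤ)
    (s : Chain G p) : eval a (cap h b s) = eval (cupFun h a b) s := by
  induction s using Finsupp.induction_linear with
  | zero => simp
  | add s t hs ht => simp only [map_add, hs, ht]
  | single g t => rw [cap, eval_single, map_smul, eval_single, eval_single, cupFun]

/-- Dual to the Leibniz rule for `cupFun`: the term containing `delta (val b)` vanishes. No sign
appears because the cocycle sits on the back face. -/
theorem boundary_cap {m n p : ℕ} (h : m + n = p) (b : Cocycle G ℤ n) (s : Chain G (p + 1)) :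
    boundary (cap (show m + 1 + n = p + 1 by omega) (val b) s) = cap h (val b) (boundary s) :=
  chain_ext fun a => by
    rw [eval_boundary, eval_cap, eval_cap, eval_boundary, delta_cupFun, delta_val, eval_add]
    have : cupFun (show m + (n + 1) = p + 1 by omega) a (0 : (Fin (n + 1) → G) → ℤ) = 0 := by
      funext g; simp [cupFun]
    rw [this, smul_zero, eval_zero, add_zero]

theorem cap_chainMap {m n p : ℕ} (h : m + n = p) (f : G → H) (b : (Fin n → H) → ℤ)
    (s : Chain G p) : cap h b (chainMap f p s) = chainMap f m (cap h (fun g => b (f ∘ g)) s) :=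
  chain_ext fun a => by rw [eval_cap, eval_chainMap, eval_chainMap, eval_cap, cupFun_comp]

/-- The cap product with an integral cocycle is natural. -/
theorem exists_cap (f : G →* H) {n k p : ℕ} (h : n + 1 + k = p + 1) (c : Cocycle H ℤ k)
    (σ : Homol G (p + 1)) :
    ∃ τ : Homol G (n + 1),
      (∀ {A : Type} [AddCommGroup A] (x : Cocycle G A (n + 1)),
        evalCocycle x τ = evalCocycle (cupCocycle h x (Cocycle.comp c f)) σ) ∧
      (homolMap f (p + 1) σ = 0 → homolMap f (n + 1) τ = 0) := by
  obtain ⟨z, hz, rfl⟩ := homolCls_surjective σ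
  have hp : n + k = p := by omega
  have hcz : boundary (cap h (val (Cocycle.comp c f)) z) = 0 := by
    rw [boundary_cap hp, hz, map_zero]
  refine ⟨homolCls _ hcz, fun x => ?_, fun h0 => ?_⟩
  · rw [evalCocycle_homolCls, evalCocycle_homolCls, val_cupCocycle, eval_cap]
  · rw [homolMap_homolCls, homolCls_eq_zero_iff] at h0 ⊢
    obtain ⟨t, ht⟩ := h0
    -- A chain bounding the image cycle, capped with `c`, bounds the capped image cycle.
    refine ⟨cap (show n + 2 + k = p + 2 by omega) (val c) t, ?_⟩
    rw [boundary_cap h, ht, cap_chainMap, val_comp]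

/-! ### A degree-two chain map for finite groups and its fundamental cycles. -/

/-- The average `f ↦ ∑ₓ f(-, x, g)` over a finite group. -/
def sumSnoc [Fintype G] (g : G) {n : ℕ} (f : (Fin (n + 2) → G) → A) : (Fin n → G) → A :=
  fun w => ∑ x : G, f (Fin.snoc (Fin.snoc w x) g)

theorem contractNth_castSucc_snoc {n : ℕ} (w : Fin (n + 1) → G) (x : G) (j : Fin n) :
    Fin.contractNth j.castSucc.castSucc (· * ·) (Fin.snoc w x : Fin (n + 2) → G) =
      Fin.snoc (Fin.contractNth j.castSucc (· * ·) w) x := by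
  funext i
  refine Fin.lastCases ?_ (fun i => ?_) i
  · rw [Fin.snoc_last, Fin.contractNth_apply_of_gt _ _ _ _ (by simp), Fin.succ_last, Fin.snoc_last]
  · rw [Fin.snoc_castSucc]
    simp only [Fin.contractNth, Fin.snoc_castSucc, Fin.succ_castSucc, Fin.val_castSucc]

theorem contractNth_last_castSucc_snoc {n : ℕ} (w : Fin (n + 1) → G) (x : G) :
    Fin.contractNth (Fin.last n).castSucc (· * ·) (Fin.snoc w x : Fin (n + 2) → G) =
      Fin.snoc (fun i => w i.castSucc) (w (Fin.last n) * x) := by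
  funext i
  refine Fin.lastCases ?_ (fun i => ?_) i
  · rw [Fin.snoc_last, Fin.contractNth_apply_of_eq _ _ _ _ (by simp), Fin.snoc_castSucc,
      Fin.succ_last, Fin.snoc_last]
  · rw [Fin.snoc_castSucc, Fin.contractNth_apply_of_lt _ _ _ _ (by simp), Fin.snoc_castSucc]

theorem contractNth_last_snoc {n : ℕ} (w : Fin n → G) (x : G) :
    Fin.contractNth (Fin.last n) (· * ·) (Fin.snoc w x : Fin (n + 1) → G) = w := by
  funext i
  rw [Fin.contractNth_apply_of_lt _ _ _ _ (by simp), Fin.snoc_castSucc]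

theorem tail_snoc {n : ℕ} (w : Fin (n + 1) → G) (x : G) :
    (fun i : Fin (n + 1) => (Fin.snoc w x : Fin (n + 2) → G) i.succ) =
      Fin.snoc (fun i => w i.succ) x := by
  funext i
  refine Fin.lastCases ?_ (fun i => ?_) i
  · rw [Fin.snoc_last, Fin.succ_last, Fin.snoc_last]
  · rw [Fin.snoc_castSucc, Fin.succ_castSucc, Fin.snoc_castSucc]

/-- In `δ f (w, x, g)`, summed over `x`, contracting `x` with `g` and deleting `g` contribute the
same sum with opposite signs. Contracting the last entry of `w` with `x` only permutes the summation
variable, so it gives the term in which that last entry is deleted. The remaining terms agree one by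
one. -/
theorem delta_sumSnoc [Fintype G] (g : G) {n : ℕ} (f : (Fin (n + 2) → G) → A) :
    delta (sumSnoc g f) = sumSnoc g (delta f) := by
  funext w
  have h1 : ∑ x : G, f (Fin.snoc (Fin.snoc (fun i => w i.castSucc) (w (Fin.last n) * x)) g) =
      ∑ x : G, f (Fin.snoc (Fin.snoc (fun i => w i.castSucc) x) g) :=
    Equiv.sum_comp (Equiv.mulLeft (w (Fin.last n)))
      fun x => f (Fin.snoc (Fin.snoc (fun i => w i.castSucc) x) g)
  have h2 : ∑ x : G, f (Fin.snoc w (x * g)) = ∑ x : G, f (Fin.snoc w x) :=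
    Equiv.sum_comp (Equiv.mulRight g) fun x => f (Fin.snoc w x)
  have h3 : Fin.contractNth (Fin.last n) (· * ·) w = fun i => w i.castSucc := by
    funext i
    rw [Fin.contractNth_apply_of_lt _ _ _ _ (by simp)]
  have e1 : ∀ x : G, Fin.contractNth (Fin.last n).castSucc.castSucc (· * ·)
      (Fin.snoc (Fin.snoc w x) g : Fin (n + 3) → G) =
      Fin.snoc (Fin.snoc (fun i => w i.castSucc) (w (Fin.last n) * x)) g := fun x => by
    rw [contractNth_castSucc_snoc, contractNth_last_castSucc_snoc]
  have e2 : ∀ x : G, Fin.contractNth (Fin.last (n + 1)).castSucc (· * ·)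
      (Fin.snoc (Fin.snoc w x) g : Fin (n + 3) → G) = Fin.snoc w (x * g) := fun x => by
    rw [contractNth_last_castSucc_snoc]
    simp
  have e3 : ∀ (x : G) (j : Fin n), Fin.contractNth j.castSucc.castSucc.castSucc (· * ·)
      (Fin.snoc (Fin.snoc w x) g : Fin (n + 3) → G) =
      Fin.snoc (Fin.snoc (Fin.contractNth j.castSucc (· * ·) w) x) g := fun x j => by
    rw [contractNth_castSucc_snoc, contractNth_castSucc_snoc]
  simp only [sumSnoc, delta_apply, Fin.sum_univ_castSucc, tail_snoc, e1, e2, e3,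
    contractNth_last_snoc, Finset.sum_add_distrib, h3, ← Finset.smul_sum, h1, h2]
  rw [Finset.sum_comm]
  simp only [← Finset.smul_sum, Fin.val_castSucc, Fin.val_last, pow_succ]
  simp

/-- The chain map `[w] ↦ ∑ₓ [w, x, g]` over a finite group. -/
def snocNorm [Fintype G] (g : G) (n : ℕ) : Chain G n →ₗ[ℤ] Chain G (n + 2) :=
  eval (sumSnoc g fun w => Finsupp.single w 1)

theorem eval_snocNorm [Fintype G] (g : G) {n : ℕ} (f : (Fin (n + 2) → G) → A) (s : Chain G n) :
    eval f (snocNorm g n s) = eval (sumSnoc g f) s := by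
  induction s using Finsupp.induction_linear with
  | zero => simp
  | add s t hs ht => simp only [map_add, hs, ht]
  | single w t => simp [snocNorm, eval_single, sumSnoc, map_sum]

theorem boundary_snocNorm [Fintype G] (g : G) {n : ℕ} (s : Chain G (n + 1)) :
    boundary (snocNorm g (n + 1) s) = snocNorm g n (boundary s) :=
  chain_ext fun f => by
    rw [eval_boundary, eval_snocNorm, eval_snocNorm, eval_boundary, delta_sumSnoc]

/-- This makes the chain map `snocNorm` undo a cup product with `c`, up to the integer `∑ₓ c(x, g)`.
-/
theorem sumSnoc_cupFun [Fintype G] (g : G) {n : ℕ} (a : (Fin n → G) → A)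
    (c : (Fin 2 → G) → ℤ) :
    sumSnoc g (cupFun rfl a c) = (∑ x : G, c ![x, g]) • a := by
  funext w
  rw [sumSnoc, Pi.smul_apply, Finset.sum_smul]
  refine Finset.sum_congr rfl fun x _ => ?_
  rw [cupFun]
  congr 2
  · funext i
    fin_cases i
    · exact (Fin.snoc_castSucc (α := fun _ => G) g (Fin.snoc w x) (Fin.last n)).trans
        (Fin.snoc_last (α := fun _ => G) x w)
    · exact Fin.snoc_last (α := fun _ => G) g (Fin.snoc w x)
  · funext i
    exact (Fin.snoc_castSucc (α := fun _ => G) g (Fin.snoc w x) i.castSucc).trans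
        (Fin.snoc_castSucc (α := fun _ => G) x w i)

/-- The fundamental cycle `∑ [g, x₁, g, …, x_j, g]` of a finite group. -/
def fundCycle [Fintype G] (g : G) : (j : ℕ) → Chain G (2 * j + 1)
  | 0 => Finsupp.single (fun _ => g) 1
  | j + 1 => snocNorm g (2 * j + 1) (fundCycle g j)

theorem boundary_fundCycle [Fintype G] (g : G) (j : ℕ) : boundary (fundCycle g j) = 0 := by
  induction j with
  | zero =>
    refine chain_ext fun f => ?_
    rw [eval_boundary, fundCycle, eval_single, map_zero, delta_apply]
    simp [Subsingleton.elim _ (![] : Fin 0 → G)]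
  | succ j ih => exact (boundary_snocNorm g (n := 2 * j) _).trans (by rw [ih, map_zero])

/-! ### Odd homology of finite cyclic groups. -/

/-- The periodic resolution computes odd homology as the kernel of `g - 1` modulo the image of the
norm. On the trivial module `ℤ` the former is everything and the norm is multiplication by the
order. -/
theorem exists_generator_homol_comm {G : Type} [CommGroup G] [Fintype G] (g : G)
    (hg : ∀ x, x ∈ Subgroup.zpowers g) (j : ℕ) :
    ∃ u : Homol G (2 * j + 1), Fintype.card G • u = 0 ∧ ∀ σ, ∃ m : ℤ, σ = m • u := by
  classical
  have hi : Odd (2 * j + 1) := ⟨j, rfl⟩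
  let R := Rep.trivial ℤ G ℤ
  let K := LinearMap.ker (R.applyAsHom g - CategoryTheory.CategoryStruct.id R).hom.toLinearMap
  let π : K →ₗ[ℤ] Homol G (2 * j + 1) :=
    (Rep.FiniteCyclicGroup.groupHomologyπOdd R g hg (2 * j + 1) hi).hom
  -- The projection is a composite of isomorphisms with the quotient map onto homology.
  have hs : Function.Surjective π :=
    (ModuleCat.epi_iff_surjective (Rep.FiniteCyclicGroup.groupHomologyπOdd R g hg (2 * j + 1) hi)).1
      (CategoryTheory.epi_comp' (@CategoryTheory.IsIso.epi_of_iso _ _ _ _ _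
          (CategoryTheory.Iso.isIso_inv
            (Rep.FiniteCyclicGroup.normHomCompSub R g).moduleCatCyclesIso))
        (CategoryTheory.epi_comp' inferInstance (CategoryTheory.IsIso.epi_of_iso _)))
  have hk : (1 : ℤ) ∈ K := by
    change (R.applyAsHom g - CategoryTheory.CategoryStruct.id R).hom (1 : ℤ) = 0
    rw [Rep.sub_hom]
    exact sub_self (1 : ℤ)
  let e : K := ⟨(1 : ℤ), hk⟩
  refine ⟨π e, ?_, fun σ => ?_⟩
  · rw [← map_nsmul]
    refine (Rep.FiniteCyclicGroup.groupHomologyπOdd_eq_zero_iff R g hg (2 * j + 1) hi _).2 ?_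
    refine ⟨(1 : ℤ), ?_⟩
    refine (LinearMap.sum_apply _ _ _).trans ?_
    refine (Finset.sum_const (1 : ℤ)).trans ?_
    rfl
  · obtain ⟨⟨t, ht⟩, rfl⟩ := hs σ
    refine ⟨(t : ℤ), ?_⟩
    rw [← map_zsmul]
    refine congrArg π (Subtype.ext ?_)
    exact (mul_one (t : ℤ)).symm

/-- The homology of a finite cyclic group in odd degrees is cyclic and killed by the order of the
group. -/
theorem exists_generator_homol {G : Type} [i : Group G] [Fintype G] (g : G)
    (hg : ∀ x, x ∈ Subgroup.zpowers g) (j : ℕ) :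
    ∃ u : Homol G (2 * j + 1), Fintype.card G • u = 0 ∧ ∀ σ, ∃ m : ℤ, σ = m • u :=
  let _ : CommGroup G := { i with
    mul_comm := fun a b => by
      obtain ⟨m, rfl⟩ := hg a
      obtain ⟨n, rfl⟩ := hg b
      exact zpow_mul_comm g m n }
  exists_generator_homol_comm g hg j

theorem evalCocycle_congr {n : ℕ} {x y : Cocycle G A n} (h : val x = val y) :
    evalCocycle x = evalCocycle y := by
  rw [val_injective h]

theorem evalCocycle_homolMap (f : G →* H) {n : ℕ} (x : Cocycle H A (n + 1))
    (σ : Homol G (n + 1)) :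
    evalCocycle x (homolMap f (n + 1) σ) = evalCocycle (Cocycle.comp x f) σ := by
  obtain ⟨z, hz, rfl⟩ := homolCls_surjective σ
  rw [homolMap_homolCls, evalCocycle_homolCls, evalCocycle_homolCls, eval_chainMap, val_comp]

theorem chainMap_injective {f : G → H} (hf : Function.Injective f) (n : ℕ) :
    Function.Injective (chainMap f n) :=
  Finsupp.mapDomain_injective hf.comp_left

/-- A class is induced from every subgroup containing all entries of a representing cycle. -/
theorem exists_homolMap_subtype {n : ℕ} (C : Subgroup G) {z : Chain G (n + 1)}
    (hz : boundary z = 0) (hC : ∀ w ∈ z.support, ∀ i, w i ∈ C) :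
    ∃ τ : Homol C (n + 1), homolMap C.subtype (n + 1) τ = homolCls z hz := by
  have hi : Function.Injective C.subtype := C.subtype_injective
  let z' : Chain C (n + 1) := z.comapDomain (fun w => C.subtype ∘ w) hi.comp_left.injOn
  have hz' : chainMap C.subtype (n + 1) z' = z := by
    refine Finsupp.mapDomain_comapDomain _ hi.comp_left z fun w hw => ?_
    exact ⟨fun i => ⟨w i, hC w hw i⟩, rfl⟩
  -- The boundary vanishes already in the subgroup, because its chains embed in those of `G`.
  have h0 : boundary z' = 0 := chainMap_injective hi n (by
    rw [← boundary_chainMap, hz', hz, map_zero])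
  refine ⟨homolCls z' h0, ?_⟩
  rw [homolMap_homolCls]
  simp only [hz']

/-! ### Rational primitives and the pairing with `x ∪ c^j`. -/

/-- The pairing of `H_{2j+1}(G; ℤ)` with `x ∪ c^j`. -/
def cupPowEval {n p : ℕ} (x : Cocycle G A n) (c : Cocycle G ℤ 2) (j : ℕ) (h : n + 2 * j = p) :
    Homol G p →+ A :=
  evalCocycle (cupCocycle h x (cocyclePow c j))

theorem cupPowEval_homolMap (f : G →* H) {n p : ℕ} (x : Cocycle H A n) (c : Cocycle H ℤ 2) (j : ℕ)
    (h : n + 2 * j = p + 1) (σ : Homol G (p + 1)) :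
    cupPowEval x c j h (homolMap f (p + 1) σ) =
      cupPowEval (Cocycle.comp x f) (Cocycle.comp c f) j h σ := by
  rw [cupPowEval, evalCocycle_homolMap, cupPowEval]
  refine DFunLike.congr_fun (evalCocycle_congr ?_) σ
  rw [val_comp, val_cupCocycle, val_cupCocycle, cupFun_comp, val_comp, val_cocyclePow_comp]

/-- The rational `1`-cochain `u` has coboundary `c`, and `x` is its reduction modulo `ℤ`. -/
structure IsPrimitive (u : G → ℚ) (c : Cocycle G ℤ 2) (x : Cocycle G QModZ 1) : Prop where
  delta_eq : ∀ a b, ((val c ![a, b] : ℤ) : ℚ) = u a + u b - u (a * b)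
  red : ∀ w, val x w = QuotientAddGroup.mk (u (w 0))

theorem mk_intCast (m : ℤ) : (QuotientAddGroup.mk (m : ℚ) : QModZ) = 0 :=
  (QuotientAddGroup.eq_zero_iff _).2 ⟨m, by simp⟩

theorem addOrderOf_mk_inv {N : ℕ} (hN : 0 < N) :
    addOrderOf (QuotientAddGroup.mk (N : ℚ)⁻¹ : QModZ) = N := by
  have := AddCircle.addOrderOf_period_div (p := (1 : ℚ)) hN
  rwa [one_div] at this

namespace IsPrimitive

variable {u : G → ℚ} {c : Cocycle G ℤ 2} {x : Cocycle G QModZ 1}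

theorem comp (h : IsPrimitive u c x) (f : H →* G) :
    IsPrimitive (fun a => u (f a)) (Cocycle.comp c f) (Cocycle.comp x f) where
  delta_eq a b := by
    rw [map_mul, ← h.delta_eq, val_comp]
    refine congrArg (fun w => ((val c w : ℤ) : ℚ)) (funext fun i => ?_)
    fin_cases i <;> rfl
  red w := by
    rw [val_comp]
    exact h.red _

/-- The homomorphism to `ℚ/ℤ` given by a rational primitive. -/
def hom (h : IsPrimitive u c x) : G →* Multiplicative QModZ :=
  MonoidHom.mk' (fun a => Multiplicative.ofAdd (QuotientAddGroup.mk (u a) : QModZ)) fun a b => by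
    have : u a + u b = u (a * b) + ((val c ![a, b] : ℤ) : ℚ) := by rw [h.delta_eq]; ring
    rw [← ofAdd_add, ← QuotientAddGroup.mk_add, this, QuotientAddGroup.mk_add, mk_intCast, add_zero]

/-- Summing `δ u = c` over the group, the two sums of `u` cancel by translation invariance and leave
N·u(g), with N the group order. If u(g) = 1/N + m, this integer is 1 + mN, which acts as the
identity on N-torsion. -/
theorem sum_smul [Fintype G] (h : IsPrimitive u c x) {g : G}
    (hg : (QuotientAddGroup.mk (u g) : QModZ) = QuotientAddGroup.mk (Fintype.card G : ℚ)⁻¹) :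
    (∑ y : G, val c ![y, g]) • (QuotientAddGroup.mk (u g) : QModZ) = QuotientAddGroup.mk (u g) := by
  have hN : (Fintype.card G : ℚ) ≠ 0 := by exact_mod_cast Fintype.card_ne_zero
  have h1 : ((∑ y : G, val c ![y, g] : ℤ) : ℚ) = Fintype.card G * u g := by
    rw [Int.cast_sum]
    simp only [h.delta_eq, Finset.sum_sub_distrib, Finset.sum_add_distrib]
    rw [show ∑ y : G, u (y * g) = ∑ y : G, u y from Equiv.sum_comp (Equiv.mulRight g) u]
    simp
  obtain ⟨m, hm⟩ := (QuotientAddGroup.eq).1 hg.symm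
  have h2 : u g = (Fintype.card G : ℚ)⁻¹ + m := by
    have : (m : ℚ) = -(Fintype.card G : ℚ)⁻¹ + u g := by simpa using hm
    rw [this]; ring
  have h3 : ∑ y : G, val c ![y, g] = 1 + m * (Fintype.card G : ℤ) := by
    have : ((∑ y : G, val c ![y, g] : ℤ) : ℚ) = 1 + m * Fintype.card G := by
      rw [h1, h2]; field_simp
    exact_mod_cast this
  have h4 : (Fintype.card G : ℤ) • (QuotientAddGroup.mk (u g) : QModZ) = 0 := by
    rw [hg, natCast_zsmul]
    have := addOrderOf_nsmul_eq_zero (QuotientAddGroup.mk (Fintype.card G : ℚ)⁻¹ : QModZ)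
    rwa [addOrderOf_mk_inv Fintype.card_pos] at this
  rw [h3, add_smul, one_smul, mul_smul, h4, smul_zero, add_zero]

/-- Each step from `j` to `j + 1` multiplies the value by `∑ c(y, g)`, which fixes it by `sum_smul`.
-/
theorem cupPowEval_fundCycle [Fintype G] (h : IsPrimitive u c x) {g : G}
    (hg : (QuotientAddGroup.mk (u g) : QModZ) = QuotientAddGroup.mk (Fintype.card G : ℚ)⁻¹)
    (j : ℕ) :
    cupPowEval x c j (show 1 + 2 * j = 2 * j + 1 by omega)
      (homolCls (fundCycle g j) (boundary_fundCycle g j)) = QuotientAddGroup.mk (u g) := by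
  rw [cupPowEval, evalCocycle_homolCls, val_cupCocycle]
  induction j with
  | zero =>
    rw [cupFun_cocyclePow_zero, fundCycle, eval_single, h.red, one_smul]
  | succ j ih =>
    rw [cupFun_cocyclePow_succ j _ (show 1 + 2 * j = 2 * j + 1 by omega) rfl]
    refine (eval_snocNorm g _ _).trans ?_
    rw [sumSnoc_cupFun]
    have : ∀ (m : ℤ) (a : (Fin (2 * j + 1) → G) → QModZ) (s : Chain G (2 * j + 1)),
        eval (m • a) s = m • eval a s := fun m a s => eval_comp (zsmulAddGroupHom m) a s
    rw [this, ih, h.sum_smul hg]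

/-- The fundamental cycle is some multiple `m • v` of the generator and its value has exact order N.
If `k • v` pairs to zero, then k/N is an integer, so `k • v` vanishes because N kills `v`. Whether
the fundamental cycle itself generates is not needed. -/
theorem cupPowEval_injective_of_cyclic [Fintype G] (h : IsPrimitive u c x) {g : G}
    (hg : (QuotientAddGroup.mk (u g) : QModZ) = QuotientAddGroup.mk (Fintype.card G : ℚ)⁻¹)
    (hgen : ∀ y, y ∈ Subgroup.zpowers g) (j : ℕ) :
    Function.Injective (cupPowEval x c j (show 1 + 2 * j = 2 * j + 1 by omega)) := by
  obtain ⟨v, hv, hgv⟩ := exists_generator_homol g hgen j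
  refine (injective_iff_map_eq_zero _).2 fun σ hσ => ?_
  obtain ⟨m, hm⟩ := hgv (homolCls (fundCycle g j) (boundary_fundCycle g j))
  obtain ⟨k, rfl⟩ := hgv σ
  have h1 := h.cupPowEval_fundCycle hg j
  rw [hm, map_zsmul, hg] at h1
  have h2 : k • (QuotientAddGroup.mk (Fintype.card G : ℚ)⁻¹ : QModZ) = 0 := by
    rw [← h1, smul_comm, ← map_zsmul, hσ, smul_zero]
  rw [← addOrderOf_dvd_iff_zsmul_eq_zero, addOrderOf_mk_inv Fintype.card_pos] at h2
  obtain ⟨t, rfl⟩ := h2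
  rw [mul_smul, smul_comm, natCast_zsmul, hv]
  exact zsmul_zero t

/-- An element on which the primitive is `1/N` modulo `ℤ` has order `N`. -/
theorem card_zpowers (h : IsPrimitive u c x) (hi : Function.Injective h.hom) {N : ℕ} (hN : 0 < N)
    {g : G} (hg : (QuotientAddGroup.mk (u g) : QModZ) = QuotientAddGroup.mk (N : ℚ)⁻¹) :
    Nat.card (Subgroup.zpowers g) = N := by
  rw [Nat.card_zpowers, ← orderOf_injective h.hom hi g]
  refine Eq.trans ?_ (addOrderOf_mk_inv hN)
  rw [← orderOf_ofAdd_eq_addOrderOf, ← hg]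
  rfl

/-- The group is a directed union of finite cyclic subgroups generated by elements of value `1/N`,
and each class is induced from one of them. -/
theorem cupPowEval_bijective (h : IsPrimitive u c x) (hb : Function.Bijective h.hom) (j : ℕ) :
    Function.Bijective (cupPowEval x c j (show 1 + 2 * j = 2 * j + 1 by omega)) := by
  have hroot : ∀ N : ℕ, ∃ g : G, (QuotientAddGroup.mk (u g) : QModZ) =
      QuotientAddGroup.mk (N : ℚ)⁻¹ := fun N =>
    hb.2 (Multiplicative.ofAdd (QuotientAddGroup.mk (N : ℚ)⁻¹ : QModZ))
  have hgen : ∀ g : G, ∀ y : Subgroup.zpowers g,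
      y ∈ Subgroup.zpowers (⟨g, Subgroup.mem_zpowers g⟩ : Subgroup.zpowers g) := by
    rintro g ⟨_, k, rfl⟩
    exact ⟨k, by ext; simp⟩
  have hfin : ∀ {N : ℕ} (hN : 0 < N) {g : G}
      (hg : (QuotientAddGroup.mk (u g) : QModZ) = QuotientAddGroup.mk (N : ℚ)⁻¹),
      ∃ i : Fintype (Subgroup.zpowers g), @Fintype.card (Subgroup.zpowers g) i = N := by
    intro N hN g hg
    have hc := h.card_zpowers hb.1 hN hg
    have : Finite (Subgroup.zpowers g) := Nat.finite_of_card_ne_zero (by omega)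
    exact ⟨Fintype.ofFinite _, by rw [Fintype.card_eq_nat_card, hc]⟩
  constructor
  · refine (injective_iff_map_eq_zero _).2 fun σ hσ => ?_
    obtain ⟨z, hz, rfl⟩ := homolCls_surjective σ
    classical
    let E : Finset G := z.support.biUnion fun w => Finset.univ.image w
    -- N is a common denominator of `u` on all entries of the cycle, so each value is a multiple of
    -- `1/N` and, by injectivity of `h.hom`, each entry is a power of `g`.
    let N : ℕ := ∏ y ∈ E, (u y).den
    have hN : 0 < N := Finset.prod_pos fun y _ => (u y).pos
    obtain ⟨g, hg⟩ := hroot N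
    obtain ⟨_, hcard⟩ := hfin hN hg
    have hE : ∀ y ∈ E, y ∈ Subgroup.zpowers g := fun y hy => by
      obtain ⟨t, ht⟩ := Finset.dvd_prod_of_mem (fun y => (u y).den) hy
      have ht' : (N : ℚ) = (u y).den * t := by exact_mod_cast ht
      refine ⟨(u y).num * t, hb.1 ?_⟩
      simp only [map_zpow]
      change Multiplicative.ofAdd (((u y).num * t : ℤ) • (QuotientAddGroup.mk (u g) : QModZ)) =
        Multiplicative.ofAdd (QuotientAddGroup.mk (u y) : QModZ)
      rw [hg]
      refine congrArg (fun q : ℚ => Multiplicative.ofAdd (QuotientAddGroup.mk q : QModZ))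
        (?_ : ((u y).num * t : ℤ) • (N : ℚ)⁻¹ = u y)
      have hN0 : (N : ℚ) ≠ 0 := by exact_mod_cast hN.ne'
      rw [ht'] at hN0 ⊢
      conv_rhs => rw [← Rat.num_div_den (u y)]
      have ht0 : (t : ℚ) ≠ 0 := right_ne_zero_of_mul hN0
      have hd0 : ((u y).den : ℚ) ≠ 0 := left_ne_zero_of_mul hN0
      simp only [zsmul_eq_mul, Int.cast_mul, Int.cast_natCast]
      field_simp
    obtain ⟨τ, hτ⟩ := exists_homolMap_subtype (Subgroup.zpowers g) hz fun w hw i =>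
      hE _ (Finset.mem_biUnion.2 ⟨w, hw, Finset.mem_image_of_mem _ (Finset.mem_univ i)⟩)
    rw [← hτ] at hσ ⊢
    rw [cupPowEval_homolMap] at hσ
    have := (injective_iff_map_eq_zero _).1 ((h.comp (Subgroup.zpowers g).subtype
      ).cupPowEval_injective_of_cyclic (g := ⟨g, Subgroup.mem_zpowers g⟩)
        (by rw [hcard]; exact hg) (hgen g) j) τ hσ
    rw [this, map_zero]
  · intro q
    obtain ⟨q, rfl⟩ := QuotientAddGroup.mk_surjective q
    obtain ⟨g, hg⟩ := hroot q.den
    obtain ⟨_, hcard⟩ := hfin q.pos hg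
    refine ⟨q.num • homolMap (Subgroup.zpowers g).subtype (2 * j + 1)
      (homolCls (fundCycle ⟨g, Subgroup.mem_zpowers g⟩ j) (boundary_fundCycle _ j)), ?_⟩
    rw [map_zsmul, cupPowEval_homolMap, (h.comp (Subgroup.zpowers g).subtype).cupPowEval_fundCycle
      (by rw [hcard]; exact hg)]
    change q.num • (QuotientAddGroup.mk (u g) : QModZ) = _
    rw [hg]
    refine congrArg (QuotientAddGroup.mk : ℚ → QModZ) (?_ : q.num • (q.den : ℚ)⁻¹ = q)
    rw [zsmul_eq_mul, ← div_eq_mul_inv, Rat.num_div_den]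

end IsPrimitive

/-! ### Constructing primitives, and descent by the cap product. -/

/-- `cocyclePow` multiplies by `c` on the right, whereas `δ (u ∪ c^j)` produces a factor `c` on the
left. -/
theorem cupFun_cocyclePow_self (c : Cocycle G ℤ 2) (j : ℕ) :
    cupFun (show 2 + 2 * j = 2 * (j + 1) by omega) (val c) (val (cocyclePow c j)) =
      val (cocyclePow c (j + 1)) := by
  induction j with
  | zero =>
    rw [cupFun_cocyclePow_zero, val_cocyclePow_succ, cocyclePow, oneCocycle, val_mkCocycle]
    funext g
    simp only [cupFun, smul_eq_mul, mul_one]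
    refine congrArg (val c) (funext fun i => congrArg g ?_)
    ext; simp
  | succ j ih =>
    rw [cupFun_cocyclePow_succ j _ (show 2 + 2 * j = 2 * (j + 1) by omega) rfl, ih]
    exact (val_cocyclePow_succ c (j + 1)).symm

/-- The reduction modulo `ℤ` of a rational cochain with integral coboundary. -/
def redCocycle {n : ℕ} (a : (Fin n → G) → ℚ) (b : (Fin (n + 1) → G) → ℤ)
    (h : delta a = fun g => (b g : ℚ)) : Cocycle G QModZ n :=
  mkCocycle (fun g => QuotientAddGroup.mk (a g)) (by
    refine (delta_map (QuotientAddGroup.mk' (AddSubgroup.zmultiples (1 : ℚ))) a).trans ?_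
    rw [h]
    exact funext fun g => mk_intCast _)

theorem val_redCocycle {n : ℕ} (a : (Fin n → G) → ℚ) (b : (Fin (n + 1) → G) → ℤ)
    (h : delta a = fun g => (b g : ℚ)) :
    val (redCocycle a b h) = fun g => QuotientAddGroup.mk (a g) := val_mkCocycle _ _

theorem delta_one_apply (a : (Fin 1 → G) → A) (g : Fin 2 → G) :
    delta a g = a (fun _ => g 0) + a (fun _ => g 1) - a (fun _ => g 0 * g 1) := by
  rw [delta_apply, Fin.sum_univ_two]
  have e0 : (fun i : Fin 1 => g i.succ) = fun _ => g 1 := by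
    funext i; fin_cases i; rfl
  have e1 : Fin.contractNth 0 (· * ·) g = fun _ : Fin 1 => g 0 * g 1 := by
    funext i; fin_cases i; rfl
  have e2 : Fin.contractNth 1 (· * ·) g = fun _ : Fin 1 => g 0 := by
    funext i; fin_cases i; rfl
  rw [e0, e1, e2]
  simp
  abel

theorem delta_of_forall_eq (u : G → ℚ) (c : Cocycle G ℤ 2)
    (h : ∀ a b, ((val c ![a, b] : ℤ) : ℚ) = u a + u b - u (a * b)) :
    delta (fun w : Fin 1 → G => u (w 0)) = fun g => ((val c g : ℤ) : ℚ) := by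
  funext g
  rw [delta_one_apply, ← h]
  refine congrArg (fun w => ((val c w : ℤ) : ℚ)) (funext fun i => ?_)
  fin_cases i <;> rfl

theorem exists_isPrimitive (u : G → ℚ) (c : Cocycle G ℤ 2)
    (h : ∀ a b, ((val c ![a, b] : ℤ) : ℚ) = u a + u b - u (a * b)) :
    ∃ x, IsPrimitive u c x := by
  exact ⟨redCocycle _ _ (delta_of_forall_eq u c h), h, fun w => by rw [val_redCocycle]⟩

theorem exists_nsmul_eq_zero (q : QModZ) : ∃ N : ℕ, 0 < N ∧ N • q = 0 := by
  obtain ⟨q, rfl⟩ := QuotientAddGroup.mk_surjective q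
  refine ⟨q.den, q.pos, ?_⟩
  refine Eq.trans ?_ (mk_intCast q.num)
  refine congrArg (QuotientAddGroup.mk : ℚ → QModZ) (?_ : q.den • q = q.num)
  rw [nsmul_eq_mul, mul_comm, Rat.mul_den_eq_num]

/-- The cap product with `c` relates the pairings with consecutive powers of `c`. -/
theorem exists_cupPowEval_succ {T : Type} [Group T] {f : T →* G} {c : Cocycle G ℤ 2}
    {x : Cocycle T QModZ 1} (j : ℕ) (σ : Homol T (2 * (j + 1) + 1)) :
    ∃ τ : Homol T (2 * j + 1),
      cupPowEval x (Cocycle.comp c f) j (show 1 + 2 * j = 2 * j + 1 by omega) τ =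
        cupPowEval x (Cocycle.comp c f) (j + 1)
          (show 1 + 2 * (j + 1) = 2 * (j + 1) + 1 by omega) σ ∧
      (homolMap f (2 * (j + 1) + 1) σ = 0 → homolMap f (2 * j + 1) τ = 0) := by
  obtain ⟨τ, h1, h2⟩ := exists_cap f (show 2 * j + 1 + 2 = 2 * (j + 1) + 1 by omega) c σ
  refine ⟨τ, ?_, h2⟩
  rw [cupPowEval, h1, cupPowEval]
  refine DFunLike.congr_fun (evalCocycle_congr ?_) σ
  rw [val_cupCocycle, val_cupCocycle, val_cupCocycle,
    cupFun_cocyclePow_succ j _ (show 1 + 2 * j = 2 * j + 1 by omega) rfl]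

/-! ### Torsion, propagation in the degree, and secondary classes. -/

namespace IsPrimitive

variable {u : G → ℚ} {c : Cocycle G ℤ 2} {x : Cocycle G QModZ 1}

/-- Rational cocycles vanish on the odd homology, which is a torsion group. -/
theorem evalCocycle_rat_eq_zero (h : IsPrimitive u c x) (hb : Function.Bijective h.hom) {j : ℕ}
    (r : Cocycle G ℚ (2 * j + 1)) (σ : Homol G (2 * j + 1)) : evalCocycle r σ = 0 := by
  obtain ⟨N, hN, h0⟩ := exists_nsmul_eq_zero
    (cupPowEval x c j (show 1 + 2 * j = 2 * j + 1 by omega) σ)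
  have h1 : N • σ = 0 := (h.cupPowEval_bijective hb j).1 (by rw [map_nsmul, h0, map_zero])
  have h2 : N • evalCocycle r σ = 0 := by rw [← map_nsmul, h1, map_zero]
  exact (smul_eq_zero.1 h2).resolve_left hN.ne'

section
variable {T : Type} [Group T] {f : T →* G} {u : T → ℚ} {c : Cocycle G ℤ 2} {x : Cocycle T QModZ 1}

/-- If σ dies in `G`, so does its cap product τ with `c`; hence τ = 0 by induction. The pairing of σ
equals that of τ, and it detects σ. -/
theorem homolMap_injective_of_le (h : IsPrimitive u (Cocycle.comp c f) x)
    (hb : Function.Bijective h.hom) {j l : ℕ} (hjl : j ≤ l)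
    (hj : Function.Injective (homolMap f (2 * j + 1))) :
    Function.Injective (homolMap f (2 * l + 1)) := by
  induction l, hjl using Nat.le_induction with
  | base => exact hj
  | succ l _ ih =>
    refine (injective_iff_map_eq_zero _).2 fun σ hσ => ?_
    obtain ⟨τ, h1, h2⟩ := exists_cupPowEval_succ (f := f) (c := c) (x := x) l σ
    rw [(injective_iff_map_eq_zero _).1 ih τ (h2 hσ), map_zero] at h1
    exact (injective_iff_map_eq_zero _).1 (h.cupPowEval_bijective hb (l + 1)).1 σ h1.symm

/-- Contrapositively: every class τ is a cap product, because a σ with the same pairing value exists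
one step higher and the pairing below separates classes. So if the map vanishes above, it vanishes
on τ. -/
theorem homolMap_ne_zero_of_le (h : IsPrimitive u (Cocycle.comp c f) x)
    (hb : Function.Bijective h.hom) {j l : ℕ} (hjl : j ≤ l) (hj : homolMap f (2 * j + 1) ≠ 0) :
    homolMap f (2 * l + 1) ≠ 0 := by
  induction l, hjl using Nat.le_induction with
  | base => exact hj
  | succ l _ ih =>
    refine fun h0 => ih (AddMonoidHom.ext fun τ => ?_)
    obtain ⟨σ, hσ⟩ := (h.cupPowEval_bijective hb (l + 1)).2
      (cupPowEval x (Cocycle.comp c f) l (show 1 + 2 * l = 2 * l + 1 by omega) τ)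
    obtain ⟨τ', h1, h2⟩ := exists_cupPowEval_succ (f := f) (c := c) (x := x) l σ
    rw [← (h.cupPowEval_bijective hb l).1 (h1.trans hσ)]
    exact h2 (by rw [h0]; rfl)

/-- A secondary class of a power of `c` restricts to the product of the primitive of `c` with
powers of `c`. -/
theorem evalCocycle_secondary (h : IsPrimitive u (Cocycle.comp c f) x)
    (hb : Function.Bijective h.hom) {j i L : ℕ} (hi : j + i = L) (a : (Fin (2 * j + 1) → G) → ℚ)
    (z : Cocycle G QModZ (2 * j + 1))
    (ha : delta a = fun g => ((val (cocyclePow c (j + 1)) g : ℤ) : ℚ))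
    (hz : val z = fun g => QuotientAddGroup.mk (a g)) (hL : 2 * j + 1 + 2 * i = 2 * L + 1)
    (σ : Homol T (2 * L + 1)) :
    evalCocycle (cupCocycle hL z (cocyclePow c i)) (homolMap f (2 * L + 1) σ) =
      cupPowEval x (Cocycle.comp c f) L (show 1 + 2 * L = 2 * L + 1 by omega) σ := by
  set c' := Cocycle.comp c f with hc'
  let ut : (Fin 1 → T) → ℚ := fun w => u (w 0)
  let af : (Fin (2 * j + 1) → T) → ℚ := fun w => a (f ∘ w)
  have daf : delta af = fun g => ((val (cocyclePow c' (j + 1)) g : ℤ) : ℚ) := by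
    rw [delta_comp, ha, val_cocyclePow_comp]
    rfl
  have dut : delta ut = fun g => ((val c' g : ℤ) : ℚ) := delta_of_forall_eq u c' h.delta_eq
  -- Both terms have coboundary `c^{L+1}`, so `r` is a rational cocycle.
  let r : (Fin (2 * L + 1) → T) → ℚ := cupFun hL af (val (cocyclePow c' i)) -
    cupFun (show 1 + 2 * L = 2 * L + 1 by omega) ut (val (cocyclePow c' L))
  have cupz : ∀ {m n p : ℕ} (e : m + n = p) (b : (Fin m → T) → ℚ),
      cupFun e b (0 : (Fin n → T) → ℤ) = 0 := fun e b => by funext g; simp [cupFun]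
  have dr : delta r = 0 := by
    rw [delta_sub, delta_cupFun, delta_cupFun, delta_val, delta_val, cupz, cupz, smul_zero,
      smul_zero, add_zero, add_zero, daf, dut, sub_eq_zero]
    refine (cupFun_map _ (Int.castAddHom ℚ) _ _).symm.trans
      (Eq.trans ?_ (cupFun_map _ (Int.castAddHom ℚ) _ _))
    -- What remains is the integral identity between `c^{j+1} ∪ c^i` and `c ∪ c^L`.
    refine congrArg (fun (b : (Fin (2 * L + 1 + 1) → T) → ℤ) g => Int.castAddHom ℚ (b g)) ?_
    subst hi
    rw [cupFun_cocyclePow_add j i _ (show 2 + 2 * j = 2 * j + 1 + 1 by omega)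
      (show 2 * j + 1 + 1 + 2 * i = 2 * (j + i) + 1 + 1 by omega)]
    refine congrArg (fun b : (Fin (2 * j + 1 + 1) → T) → ℤ => cupFun _ b _) ?_
    exact (cupFun_cocyclePow_self c' j).symm
  rw [evalCocycle_homolMap, cupPowEval]
  have h0 := h.evalCocycle_rat_eq_zero hb (mkCocycle r dr) σ
  obtain ⟨w, hw, rfl⟩ := homolCls_surjective σ
  rw [evalCocycle_homolCls, val_mkCocycle, eval_sub, sub_eq_zero] at h0
  -- The two rational values are equal; reducing them modulo `ℤ` gives the two pairings.
  have h1 := congrArg (QuotientAddGroup.mk' (AddSubgroup.zmultiples (1 : ℚ))) h0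
  rw [← eval_comp, ← eval_comp, cupFun_map, cupFun_map] at h1
  rw [evalCocycle_homolCls, evalCocycle_homolCls, val_comp, val_cupCocycle, val_cupCocycle,
    cupFun_comp, hz, ← val_cocyclePow_comp]
  have hx : val x = fun g => QuotientAddGroup.mk (ut g) := funext h.red
  rw [hx]
  exact h1

end

end IsPrimitive

/-! ### Pullback and change of coefficients on cocycles. -/

theorem pullback_cls (f : G →* H) {n : ℕ} (c : Cocycle H A n) :
    pullback f n (cls c) = cls (Cocycle.comp c f) := by
  let φ : Rep.res f (Rep.trivial ℤ H A) ⟶ Rep.trivial ℤ G A :=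
    Rep.ofHom ⟨LinearMap.id, fun _ => rfl⟩
  refine (congrArg (fun ψ => ψ.hom c) (groupCohomology.π_map (A := Rep.trivial ℤ H A)
    (B := Rep.trivial ℤ G A) f φ n)).trans ?_
  refine congrArg cls (val_injective ?_)
  rw [val_comp]
  exact congrArg (fun ψ => ψ.hom c) (HomologicalComplex.cyclesMap_i
    (groupCohomology.cochainsMap (A := Rep.trivial ℤ H A) (B := Rep.trivial ℤ G A) f φ) n)

theorem coeffMap_cls (φ : A →+ B) {n : ℕ} (c : Cocycle G A n) :
    ∃ c' : Cocycle G B n, val c' = (fun g => φ (val c g)) ∧ coeffMap φ n (cls c) = cls c' := by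
  let ψ : Rep.res (MonoidHom.id G) (Rep.trivial ℤ G A) ⟶ Rep.trivial ℤ G B :=
    Rep.ofHom ⟨φ.toIntLinearMap, fun _ => rfl⟩
  refine ⟨_, ?_, congrArg (fun θ => θ.hom c) (groupCohomology.π_map (A := Rep.trivial ℤ G A)
    (B := Rep.trivial ℤ G B) (MonoidHom.id G) ψ n)⟩
  exact congrArg (fun θ => θ.hom c) (HomologicalComplex.cyclesMap_i
    (groupCohomology.cochainsMap (A := Rep.trivial ℤ G A) (B := Rep.trivial ℤ G B)
      (MonoidHom.id G) ψ) n)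

end

end GroupClasses

/-! ### Rational rotations and the Euler class. -/

namespace CircleDiff

open GroupClasses

theorem circleParam_zero : circleParam 0 = 1 := by
  rw [circleParam, mul_zero, Circle.exp_zero]

theorem circleParam_add (s t : ℝ) : circleParam (s + t) = circleParam s * circleParam t := by
  rw [circleParam, mul_add, Circle.exp_add, circleParam, circleParam]

theorem circleParam_nsmul (n : ℕ) (t : ℝ) : circleParam (n * t) = circleParam t ^ n := by
  rw [circleParam, circleParam, ← Circle.exp_nsmul, nsmul_eq_mul]
  congr 1
  ring

/-- The translation number of the chosen lift of a rational rotation is rational, and determines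
the lift. -/
theorem exists_rat_lift (f : DiffPlus) (hf : f ∈ SO2tor) :
    ∃ q : ℚ, f = rotation (circleParam q) ∧ ∀ t, lift f t = t + q := by
  obtain ⟨a, ha, rfl⟩ := hf
  have hl := isLift_lift (rotation a)
  set F := lift (rotation a) with hF
  have h0 : circleParam (F 0) = a := by
    rw [← hl 0, circleParam_zero]
    exact mul_one a
  obtain ⟨n, hn, hpow⟩ := isOfFinOrder_iff_pow_eq_one.1 ha
  rw [← h0, ← circleParam_nsmul, ← circleParam_zero, circleParam_eq_iff] at hpow
  obtain ⟨m, hm⟩ := hpow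
  have hq : (((m / n : ℚ)) : ℝ) = F 0 := by
    have : (n : ℝ) ≠ 0 := by exact_mod_cast hn.ne'
    push_cast
    rw [div_eq_iff this]
    linarith
  -- The lift sends 0 to an angle of the rotation, and n times this angle is the integer m.
  refine ⟨m / n, by rw [hq, h0], fun t => ?_⟩
  have ht : IsLift (CircleDeg1Lift.translate (Multiplicative.ofAdd (F 0))) (rotation a) :=
      fun t => by
    rw [CircleDeg1Lift.translate_apply, circleParam_add, h0]
    rfl
  obtain ⟨k, hk⟩ := hl.eq_translate_mul ht
  have key : ∀ t, F t = k + (F 0 + t) := fun t => by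
    conv_lhs => rw [hk]
    rw [Units.val_mul, CircleDeg1Lift.mul_apply, CircleDeg1Lift.translate_apply,
      CircleDeg1Lift.translate_apply]
  -- At 0 this forces `k = 0`, so the lift is exactly the translation by `F 0`.
  have h1 := key 0
  have h2 := key t
  rw [hq]
  linarith

/-- The rational translation number of the chosen lift of a rational rotation. -/
def ratLift (f : SO2tor) : ℚ := Classical.choose (exists_rat_lift f f.2)

theorem eq_rotation_ratLift (f : SO2tor) : (f : DiffPlus) = rotation (circleParam (ratLift f)) :=
  (Classical.choose_spec (exists_rat_lift f f.2)).1

theorem lift_eq_add_ratLift (f : SO2tor) (t : ℝ) : lift f t = t + ratLift f :=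
  (Classical.choose_spec (exists_rat_lift f f.2)).2 t

/-- The chosen lifts are translations, so their composition adds the translation lengths. Thus
`ratLift` is a rational primitive of the Euler cocycle. -/
theorem eulerFun_eq_ratLift (f g : SO2tor) :
    (eulerFun f g : ℚ) = ratLift f + ratLift g - ratLift (f * g) := by
  have h := congrArg (fun U : CircleDeg1Liftˣ => U 0) (eulerFun_spec f g)
  have h' : lift f (lift g 0) = eulerFun f g + lift (f * g : DiffPlus) 0 := h
  rw [← Subgroup.coe_mul, lift_eq_add_ratLift, lift_eq_add_ratLift, lift_eq_add_ratLift] at h'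
  have : ((eulerFun f g : ℚ) : ℝ) = ((ratLift f + ratLift g - ratLift (f * g) : ℚ) : ℝ) := by
    push_cast
    linarith
  exact_mod_cast this

theorem ratLift_bijective :
    Function.Bijective fun f : SO2tor => (QuotientAddGroup.mk (ratLift f) : QModZ) := by
  constructor
  · intro f g h
    obtain ⟨m, hm⟩ := QuotientAddGroup.eq.1 h
    have hm' : (m : ℚ) = -ratLift f + ratLift g := by simpa using hm
    apply Subtype.ext
    rw [eq_rotation_ratLift f, eq_rotation_ratLift g]
    refine congrArg rotation (circleParam_eq_iff.2 ⟨-m, ?_⟩)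
    have : ratLift f = ratLift g + ((-m : ℤ) : ℚ) := by push_cast; linarith
    exact_mod_cast this
  · intro q
    obtain ⟨q, rfl⟩ := QuotientAddGroup.mk_surjective q
    have ha : circleParam q ∈ CommGroup.torsion Circle := by
      refine isOfFinOrder_iff_pow_eq_one.2 ⟨q.den, q.pos, ?_⟩
      rw [← circleParam_nsmul, ← circleParam_zero, circleParam_eq_iff]
      refine ⟨q.num, ?_⟩
      rw [zero_add]
      exact_mod_cast (mul_comm _ _).trans (Rat.mul_den_eq_num q)
    let f : SO2tor := ⟨rotation (circleParam q), Subgroup.mem_map_of_mem _ ha⟩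
    refine ⟨f, ?_⟩
    have h1 := DFunLike.congr_fun (congrArg (fun d : DiffPlus => (d : Circle ≃ₜ Circle))
      (eq_rotation_ratLift f)) 1
    have h2 : circleParam q * 1 = circleParam (ratLift f) * 1 := h1
    rw [mul_one, mul_one, circleParam_eq_iff] at h2
    obtain ⟨m, hm⟩ := h2
    have hm' : q = ratLift f + (m : ℚ) := by exact_mod_cast hm
    change (QuotientAddGroup.mk (ratLift f) : QModZ) = QuotientAddGroup.mk q
    rw [hm', QuotientAddGroup.mk_add, mk_intCast, add_zero]

theorem exists_eulerCocycle : ∃ e : Cocycle DiffPlus ℤ 2, cls e = eulerClass ∧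
    ∀ w, val e w = eulerFun (w 0) (w 1) :=
  ⟨_, rfl, fun w => congrFun (val_mkCocycle _ _) w⟩

/-- A cocycle representing the Euler class has a rational primitive on the rational rotations,
whose reduction is an isomorphism onto `ℚ/ℤ`. -/
theorem exists_isPrimitive_euler {Γ : Subgroup DiffPlus} (hΓ : SO2 ≤ Γ) (c : Cocycle Γ ℤ 2)
    (hc : cls c = eulerClassOn Γ) :
    ∃ (u : SO2tor → ℚ) (x : Cocycle SO2tor QModZ 1)
      (h : IsPrimitive u (Cocycle.comp c (torInclusion hΓ)) x), Function.Bijective h.hom := by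
  obtain ⟨e, he, hev⟩ := exists_eulerCocycle
  -- An arbitrary representative `c` differs from the restricted Euler cocycle by `δ b` with `b`
  -- integral. Adding `b` to `ratLift` gives a primitive of `c` without changing its reduction
  -- modulo `ℤ`.
  have h0 : cls (c - Cocycle.comp e Γ.subtype) = 0 := by
    rw [cls_sub, hc, eulerClassOn, ← he, pullback_cls, sub_self]
  obtain ⟨b, hb⟩ := (cls_succ_eq_zero_iff _).1 h0
  have hcv : ∀ w, val c w = eulerFun (w 0) (w 1) +
      (b (fun _ => w 0) + b (fun _ => w 1) - b (fun _ => w 0 * w 1)) := fun w => by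
    have := congrFun hb w
    rw [delta_one_apply, val_sub, val_comp] at this
    rw [this, Pi.sub_apply, hev]
    exact (add_sub_cancel _ _).symm
  obtain ⟨x, hx⟩ := exists_isPrimitive
    (fun f : SO2tor => ratLift f + b (fun _ => torInclusion hΓ f))
    (Cocycle.comp c (torInclusion hΓ)) fun f g => by
      rw [val_comp]
      refine (congrArg (Int.cast : ℤ → ℚ) (hcv _)).trans ?_
      have := eulerFun_eq_ratLift f g
      push_cast
      rw [map_mul]
      change (eulerFun (f : DiffPlus) (g : DiffPlus) : ℚ) + _ = _
      rw [this]
      simp only [Function.comp_apply, Matrix.cons_val_zero, Matrix.cons_val_one]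
      ring
  refine ⟨_, x, hx, ?_⟩
  have hh : Multiplicative.toAdd ∘ hx.hom = fun f => (QuotientAddGroup.mk (ratLift f) : QModZ) := by
    funext f
    change (QuotientAddGroup.mk (ratLift f + (b _ : ℚ)) : QModZ) = _
    rw [QuotientAddGroup.mk_add, mk_intCast, add_zero]
  refine (Multiplicative.toAdd.comp_bijective _).1 ?_
  rw [hh]
  exact ratLift_bijective

theorem exists_secondaryClass {Γ : Subgroup DiffPlus} {j : ℕ}
    (hv : RationalEulerPowVanishes Γ (j + 1)) : ∃ x, IsSecondaryClass Γ (j + 1) x := by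
  obtain ⟨c, hc⟩ := cls_surjective (eulerClassOn Γ)
  rw [RationalEulerPowVanishes, ← hc, cupPow_cls] at hv
  obtain ⟨c', hc', h⟩ := coeffMap_cls (Int.castAddHom ℚ) (cocyclePow c (j + 1))
  rw [h] at hv
  obtain ⟨a, ha⟩ := (cls_succ_eq_zero_iff (n := 2 * j + 1) c').1 hv
  rw [hc'] at ha
  exact ⟨_, c, a, redCocycle a (val (cocyclePow c (j + 1))) ha, hc, (d_eq_delta a).trans ha,
    val_redCocycle _ _ _, rfl⟩

/-- The primitive is taken for the cocycle `c` supplied by the secondary class, which is why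
primitives are needed for every representative of the Euler class. -/
theorem secondary_bijective {Γ : Subgroup DiffPlus} (hΓ : SO2 ≤ Γ) {j i L : ℕ} (hi : j + i = L)
    {x : Cohom Γ QModZ (2 * j + 1)} (hx : IsSecondaryClass Γ (j + 1) x)
    (h : 2 * j + 1 + 2 * i = 2 * L + 1) :
    Function.Bijective fun σ : Homol SO2tor (2 * L + 1) =>
      pairing (cup h x (cupPow (eulerClassOn Γ) i)) (homolMap (torInclusion hΓ) (2 * L + 1) σ) := by
  obtain ⟨c, a, z, hc, ha, hz, rfl⟩ := hx
  obtain ⟨u, y, hy, hb⟩ := exists_isPrimitive_euler hΓ c hc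
  have key := hy.evalCocycle_secondary hb hi a z ((d_eq_delta a).symm.trans ha) hz h
  rw [← hc, cupPow_cls, cup_cls, pairing_cls]
  simp only [key]
  exact hy.cupPowEval_bijective hb L

end CircleDiff

end

theorem theorem1p13 (Γ : Subgroup CircleDiff.DiffPlus) (hΓ : CircleDiff.SO2 ≤ Γ) :
    -- the homology groups of the group of rational rotations in odd degrees
    (∀ k : ℕ, 1 ≤ k →
      Nonempty (GroupClasses.Homol CircleDiff.SO2tor (2 * k - 1) ≃+ GroupClasses.QModZ)) ∧
    -- injectivity and non-triviality propagate to higher degrees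
    (∀ k : ℕ, 1 ≤ k →
      (Function.Injective
          (GroupClasses.homolMap (CircleDiff.torInclusion hΓ) (2 * k - 1)) →
        ∀ l : ℕ, k ≤ l → Function.Injective
          (GroupClasses.homolMap (CircleDiff.torInclusion hΓ) (2 * l - 1))) ∧
      (GroupClasses.homolMap (CircleDiff.torInclusion hΓ) (2 * k - 1) ≠ 0 →
        ∀ l : ℕ, k ≤ l →
          GroupClasses.homolMap (CircleDiff.torInclusion hΓ) (2 * l - 1) ≠ 0)) ∧
    -- vanishing of a power of the rational Euler class
    (∀ (k : ℕ) (hk : 1 ≤ k), CircleDiff.RationalEulerPowVanishes Γ k →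
      (∀ l : ℕ, k ≤ l → Function.Injective
        (GroupClasses.homolMap (CircleDiff.torInclusion hΓ) (2 * l - 1))) ∧
      (∃ x, CircleDiff.IsSecondaryClass Γ k x) ∧
      (∀ x, CircleDiff.IsSecondaryClass Γ k x → ∀ (l : ℕ) (hl : k ≤ l),
        Function.Bijective fun σ : GroupClasses.Homol CircleDiff.SO2tor (2 * l - 1) =>
          GroupClasses.pairing
            (GroupClasses.cup (show 2 * k - 1 + 2 * (l - k) = 2 * l - 1 by omega) x
              (GroupClasses.cupPow (CircleDiff.eulerClassOn Γ) (l - k)))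
            (GroupClasses.homolMap (CircleDiff.torInclusion hΓ) (2 * l - 1) σ))) := by
  obtain ⟨c, hc⟩ := GroupClasses.cls_surjective (CircleDiff.eulerClassOn Γ)
  obtain ⟨u, y, hy, hb⟩ := CircleDiff.exists_isPrimitive_euler hΓ c hc
  refine ⟨fun k hk => ?_, fun k hk => ⟨fun hinj l hl => ?_, fun hne l hl => ?_⟩,
    fun k hk hv => ?_⟩
  -- With `k = j + 1` the truncated difference `2 * k - 1` is `2 * j + 1` by definition.
  · obtain ⟨j, rfl⟩ := Nat.exists_eq_add_of_le' hk
    exact ⟨AddEquiv.ofBijective _ (hy.cupPowEval_bijective hb j)⟩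
  · obtain ⟨j, rfl⟩ := Nat.exists_eq_add_of_le' hk
    obtain ⟨m, rfl⟩ := Nat.exists_eq_add_of_le' (hk.trans hl)
    exact hy.homolMap_injective_of_le hb (Nat.le_of_succ_le_succ hl) hinj
  · obtain ⟨j, rfl⟩ := Nat.exists_eq_add_of_le' hk
    obtain ⟨m, rfl⟩ := Nat.exists_eq_add_of_le' (hk.trans hl)
    exact hy.homolMap_ne_zero_of_le hb (Nat.le_of_succ_le_succ hl) hne
  · obtain ⟨j, rfl⟩ := Nat.exists_eq_add_of_le' hk
    have hx := CircleDiff.exists_secondaryClass hv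
    have hbij : ∀ x, CircleDiff.IsSecondaryClass Γ (j + 1) x → ∀ (l : ℕ) (hl : j + 1 ≤ l),
        Function.Bijective fun σ : GroupClasses.Homol CircleDiff.SO2tor (2 * l - 1) =>
          GroupClasses.pairing
            (GroupClasses.cup (show 2 * (j + 1) - 1 + 2 * (l - (j + 1)) = 2 * l - 1 by omega) x
              (GroupClasses.cupPow (CircleDiff.eulerClassOn Γ) (l - (j + 1))))
            (GroupClasses.homolMap (CircleDiff.torInclusion hΓ) (2 * l - 1) σ) := by
      intro x hx l hl
      obtain ⟨L, rfl⟩ := Nat.exists_eq_add_of_le' (hk.trans hl)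
      exact CircleDiff.secondary_bijective hΓ (show j + (L + 1 - (j + 1)) = L by omega) hx _
    refine ⟨fun l hl => ?_, hx, hbij⟩
    obtain ⟨x, hx⟩ := hx
    -- The bijective pairing factors through the induced map on homology, so the latter is
    -- injective.
    exact Function.Injective.of_comp (f := fun τ => GroupClasses.pairing _ τ) (hbij x hx l hl).1
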